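/- Let $G$ be a finitely generated group and let $\mathcal P=(P_i)_{i\in I}$ be a non-empty finite family of subgroups of $G$ (repetitions allowed). The pair $(G,\mathcal P)$ is relatively finitely presented if there are a finite subset $S_0\subseteq G$ such that the canonical homomorphism $$\varphi\colon F(S_0)\ast \mathop{\ast}_{i\in I} P_i\to G$$ is surjective, and a finite subset $R$ of this free product whose normal closure is $\ker\varphi$. Let $S$ be a finite generating set of $G$. The coned-off Cayley graph $\hat\Gamma=\hat\Gamma(G,\mathcal P,S)$ is the simplicial graph with vertex set $G\sqcup\coprod_{i\in I}G/P_i$, whose edges are the pairs $\{g,g'\}$ with $g\ne g'$ in $G$ and $g^{-1}g'\in S$, and the pairs $\{g,A\}$ with $A\in\coprod_{i\in I} G/P_i$ and $g\in A$. The vertices $A\in\coprod_{i\in I} G/P_i$ are called cone vertices. An edge loop of length $n\ge 1$ is a sequence $v_1,\dots,v_n$ of vertices such that $\{v_1,v_2\},\dots,\{v_{n-1},v_n\},\{v_n,v_1\}$ are edges; it is a unicone loop if $v_k$ is a cone vertex for at most one index $k$. For $l\in\mathbb N$, let $\hat\Gamma_l$ be the $2$-complex obtained from $\hat\Gamma$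 by attaching a $2$-cell along every unicone loop of length $<l$. The graph $\hat\Gamma$ is coarsely unicone simply-connected if there is $l\in\mathbb N$ such that $\hat\Gamma_l$ is simply-connected. Then, for every finite generating set $S$ of $G$, the pair $(G,\mathcal P)$ is relatively finitely presented if and only if $\hat\Gamma(G,\mathcal P,S)$ is coarsely unicone simply-connected. -/

import Mathlib

namespace GroupPair

section RelativePresentations

variable {G ι : Type*} [Group G] (P : ι → Subgroup G) (S : Set G)

/-- The free product `F(S) * (*_{i} P i)` of the free group on `S` and the members of the
collection `P`. The collection is a family, so repetitions are allowed. -/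
abbrev RelFree : Type _ :=
  Monoid.Coprod (FreeGroup S) (Monoid.CoprodI fun i => P i)

/-- The homomorphism `F(S) * (*_{i} P i) → G` induced by the inclusions. -/
def relHom : RelFree P S →* G :=
  Monoid.Coprod.lift (FreeGroup.lift (fun s : S => (s : G)))
    (Monoid.CoprodI.lift fun i => (P i).subtype)

/-- `S` is a relative generating set of the pair. -/
def IsRelGenerating : Prop :=
  Function.Surjective (relHom P S)

/-- The pair admits a finite relative presentation `⟨S, P ∣ R⟩`: a finite relative generating set
`S` and a finite set `R` of relators that normally generates the kernel of `relHom P S`. -/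
def RelFinitelyPresented : Prop :=
  ∃ S : Set G, S.Finite ∧ IsRelGenerating P S ∧
    ∃ R : Set (RelFree P S), R.Finite ∧ Subgroup.normalClosure R = (relHom P S).ker

end RelativePresentations

section ConedOff

variable {G ι : Type*} [Group G] (P : ι → Subgroup G) (S : Set G)

/-- The vertex set `G ⊔ G/P`, where `G/P` is the disjoint union of the coset spaces `G ⧸ P i`.
The elements `Sum.inr A` are the cone vertices. -/
abbrev ConedVertex : Type _ := G ⊕ (Σ i, G ⧸ P i)

/-- The two types of edges: `{g, g'}` with `g⁻¹ g' ∈ S`, and `{g, A}` with `g` in the coset `A`. -/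
inductive ConedEdge : ConedVertex P → ConedVertex P → Prop
  | cayley (g g' : G) (h : g⁻¹ * g' ∈ S) : ConedEdge (Sum.inl g) (Sum.inl g')
  | cone (g : G) (A : Σ i, G ⧸ P i) (h : (QuotientGroup.mk g : G ⧸ P A.1) = A.2) :
      ConedEdge (Sum.inl g) (Sum.inr A)

/-- The coned-off Cayley graph, as a simplicial graph. -/
def conedOffCayleyGraph : SimpleGraph (ConedVertex P) :=
  SimpleGraph.fromRel (ConedEdge P S)

end ConedOff

section TwoComplex

variable {V : Type*} (Λ : SimpleGraph V)

/-- Closed edge walks `v₁, …, vₗ, v₁`, with their starting vertex. Those of length `l > 0` are the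
edge loops of length `l`. -/
abbrev ClosedWalk : Type _ := Σ v : V, Λ.Walk v v

variable (L : Set (ClosedWalk Λ))

/-- Disjoint union of the cells: one point for each vertex, one unit interval for each oriented
edge, and one closed unit disc for each loop in `L`. -/
abbrev Cells : Type _ :=
  (Σ _ : V, Unit) ⊕ (Σ _ : Λ.Dart, unitInterval) ⊕ (Σ _ : L, Metric.closedBall (0 : ℂ) 1)

namespace Cells

variable {Λ L}

/-- The point of the `0`-cell `v`. -/
def vert (v : V) : Cells Λ L := Sum.inl ⟨v, ()⟩

/-- The point with parameter `t` on the oriented edge `d`. -/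
def edge (d : Λ.Dart) (t : unitInterval) : Cells Λ L := Sum.inr (Sum.inl ⟨d, t⟩)

/-- The point `z` of the disc attached along the loop `p`. -/
def disc (p : L) (z : Metric.closedBall (0 : ℂ) 1) : Cells Λ L := Sum.inr (Sum.inr ⟨p, z⟩)

end Cells

/-- The gluing: an oriented edge starts at its first vertex (and so, by reversal, ends at its
second one), the two orientations of an edge are the same `1`-cell, and the boundary circle of the
disc of a loop of length `n` runs at constant speed through the `n` successive edges of the loop. -/
inductive Glue : Cells Λ L → Cells Λ L → Prop
  | start (d : Λ.Dart) : Glue (Cells.edge d 0) (Cells.vert d.fst)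
  | reverse (d : Λ.Dart) (t : unitInterval) :
      Glue (Cells.edge d t) (Cells.edge d.symm (unitInterval.symm t))
  | attach (p : L) (k : Fin p.1.2.darts.length) (t : unitInterval)
      (z : Metric.closedBall (0 : ℂ) 1)
      (hz : (z : ℂ) = Complex.exp (2 * Real.pi * Complex.I *
        (((k : ℕ) + (t : ℝ) : ℝ) / (p.1.2.length : ℝ)))) :
      Glue (Cells.disc p z) (Cells.edge (p.1.2.darts.get k) t)

/-- The topological space underlying the `2`-complex with `1`-skeleton `Λ` and one `2`-cell for
each loop in `L`, with the quotient (weak) topology. -/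
def TwoComplex : Type _ := Quot (Glue Λ L)

instance : TopologicalSpace (TwoComplex Λ L) :=
  inferInstanceAs (TopologicalSpace (Quot (Glue Λ L)))

end TwoComplex

section Unicone

variable {G ι : Type*} [Group G] (P : ι → Subgroup G) (S : Set G)

/-- The unicone loops of length `< l`: edge loops `v₁, …, vₗ'` with `0 < l' < l` such that `vᵢ` is
a cone vertex for at most one index `i`. The repetition of the starting vertex at the end of
the walk is not counted. -/
def uniconeLoops (l : ℕ) : Set (ClosedWalk (conedOffCayleyGraph P S)) :=
  {p | 0 < p.2.length ∧ p.2.length < l ∧ p.2.support.tail.countP Sum.isRight ≤ 1}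

/-- The coned-off Cayley graph is coarsely unicone simply-connected: for some `l`, attaching a
`2`-cell to each unicone loop of length `< l` yields a simply-connected space. -/
def CoarselyUniconeSimplyConnected : Prop :=
  ∃ l : ℕ, SimplyConnectedSpace (TwoComplex (conedOffCayleyGraph P S) (uniconeLoops P S l))

end Unicone

end GroupPair

open Topology
open scoped unitInterval
open Path.Homotopic.Quotient (trans_assoc trans_symm symm_trans trans_refl refl_trans)

universe u v w

/-! Both implications rest on one combinatorial criterion, `simplyConnectedSpace_twoComplex_iff`.
Label the oriented edges of a connected graph by elements of a group, inverse labels for inverse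
edges. The `2`-complex is simply connected exactly when every labelling whose product is trivial
around the attaching loops has trivial product around all closed walks.

For the criterion, such a labelling with values in `Q` glues copies of the cells into a covering
space with fibre `Q`. Over a simply connected base the lift of a closed walk closes up, so its
product is trivial (`AttachingData.holonomy_eq_one`). Conversely, label each edge by the class of
the loop that reaches it and returns along chosen paths from a base point. A potential for this
labelling corrects the chosen paths to path classes compatible with all edges. They extend over the
open stars and the disc interiors, which contract, and then the class of any path depends only on
its endpoints (`AttachingData.simplyConnectedSpace_of_potential`).

From simple connectivity to a presentation: label the coned-off graph tautologically in the quotient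
of the relative free product by all relators `w x`, with `w` a word of bounded length and `x` in
some `P i`. There are finitely many, as `w` and `i` determine `x`. A short unicone loop spells such
a relator or a short word, so all closed walks have trivial label. Every element of the kernel of
`relHom` labels a closed walk, hence is trivial in the quotient.

From a presentation to simple connectivity: given a labelling that is trivial on short unicone
loops, the relative free product acts on `G × Q` by transport along walks, the members of the
collection moving through their cone vertices. Each element acts as transport along cone-avoiding
walks whose length is bounded independently of the labelling (`exists_isTransport`), since one pass
through a cone can be replaced at the cost of a unicone loop. So the finitely many relators act
trivially, and with them the whole kernel. Any closed walk at a group element is traced by an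
element of the kernel, hence has trivial product. -/

instance : ContractibleSpace I :=
  (convex_Icc (0 : ℝ) 1).contractibleSpace ⟨0, by simp⟩

/-! ### Path classes pushed forward from simply connected spaces, and a local criterion for simple
connectivity. -/

section PathClasses

variable {X Y Z : Type*} [TopologicalSpace X] [TopologicalSpace Y] [TopologicalSpace Z]

/-- The image under `f` of the unique homotopy class of paths from `a` to `b` in a simply connected
space, with prescribed names for the endpoints. -/
noncomputable def pathClass [SimplyConnectedSpace Y] (f : C(Y, X)) (a b : Y) {x y : X}
    (hx : x = f a) (hy : y = f b) : Path.Homotopic.Quotient x y :=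
  (Path.Homotopic.Quotient.map (.mk (PathConnectedSpace.somePath a b)) f).cast hx hy

variable [SimplyConnectedSpace Y] [SimplyConnectedSpace Z]

theorem pathClass_trans (f : C(Y, X)) {a b c : Y} {x y z : X} (hx : x = f a) (hy : y = f b)
    (hz : z = f c) :
    (pathClass f a b hx hy).trans (pathClass f b c hy hz) = pathClass f a c hx hz := by
  subst hx hy hz
  simp only [pathClass, Path.Homotopic.Quotient.cast_rfl_rfl, ← Path.Homotopic.Quotient.mk_map,
    ← Path.Homotopic.Quotient.mk_trans, ← Path.map_trans]
  simp only [Path.Homotopic.Quotient.mk_map]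
  congr 1
  exact Subsingleton.elim _ _

theorem pathClass_self (f : C(Y, X)) {a : Y} {x : X} (hx hx' : x = f a) :
    pathClass f a a hx hx' = .refl x := by
  subst hx
  simp only [pathClass, Path.Homotopic.Quotient.cast_rfl_rfl]
  rw [Subsingleton.elim (Path.Homotopic.Quotient.mk (PathConnectedSpace.somePath a a))
    (Path.Homotopic.Quotient.refl a)]
  rfl

theorem pathClass_comp (f : C(Y, X)) (g : C(Z, Y)) {a b : Z} {x y : X} (hx : x = f (g a))
    (hy : y = f (g b)) :
    pathClass (f.comp g) a b hx hy = pathClass f (g a) (g b) hx hy := by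
  subst hx hy
  simp only [pathClass, Path.Homotopic.Quotient.cast_rfl_rfl]
  rw [Subsingleton.elim (Path.Homotopic.Quotient.mk (PathConnectedSpace.somePath (g a) (g b)))
    (Path.Homotopic.Quotient.map (.mk (PathConnectedSpace.somePath a b)) g)]
  rfl

/-- This is what makes path computations inside a cell automatic: a path that factors through the
characteristic map of the cell is determined by its endpoints there. -/
theorem pathClass_eq_of_comp_eq {f : C(Y, X)} {k : C(Z, X)} (g : C(Z, Y)) (h : f.comp g = k)
    {a b : Z} {a' b' : Y} (ha : g a = a') (hb : g b = b') {x y : X} (hx : x = k a) (hy : y = k b)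
    (hx' : x = f a') (hy' : y = f b') :
    pathClass k a b hx hy = pathClass f a' b' hx' hy' := by
  subst h ha hb
  exact pathClass_comp f g hx hy

theorem pathClass_of_const {f : C(Y, X)} {x : X} (h : ∀ y, f y = x) {a b : Y} {z : X}
    (hx : z = f a) (hy : z = f b) : pathClass f a b hx hy = .refl z := by
  obtain rfl : f = ContinuousMap.const Y x := ContinuousMap.ext h
  obtain rfl : z = x := hx
  simp only [pathClass]
  induction Path.Homotopic.Quotient.mk (PathConnectedSpace.somePath a b) using
    Path.Homotopic.Quotient.ind with
  | _ p => rfl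

theorem pathClass_symm (f : C(Y, X)) {a b : Y} {x y : X} (hx : x = f a) (hy : y = f b) :
    (pathClass f a b hx hy).symm = pathClass f b a hy hx := by
  have h := pathClass_trans f hx hy hx
  rw [pathClass_self] at h
  calc _ = (pathClass f a b hx hy).symm.trans
        ((pathClass f a b hx hy).trans (pathClass f b a hy hx)) := by
          rw [h, Path.Homotopic.Quotient.trans_refl]
    _ = _ := by
      rw [← Path.Homotopic.Quotient.trans_assoc, Path.Homotopic.Quotient.symm_trans,
        Path.Homotopic.Quotient.refl_trans]

theorem mk_eq_pathClass {x y : X} (p : Path x y) :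
    Path.Homotopic.Quotient.mk p =
      pathClass (p : C(I, X)) 0 1 p.source.symm p.target.symm := by
  have key : ∀ {x' y' : X} (hx : x' = p 0) (hy : y' = p 1),
      (Path.Homotopic.Quotient.mk (p.cast (hx.trans p.source) (hy.trans p.target))) =
        pathClass (p : C(I, X)) 0 1 hx hy := by
    intro x' y' hx hy
    subst hx hy
    simp only [pathClass, Path.Homotopic.Quotient.cast_rfl_rfl]
    rw [Subsingleton.elim (Path.Homotopic.Quotient.mk (PathConnectedSpace.somePath (0 : I) 1))
      (Path.Homotopic.Quotient.mk ⟨ContinuousMap.id I, rfl, rfl⟩)]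
    rfl
  exact key p.source.symm p.target.symm

/-- A space is simply connected if it has an open cover by sets that contract in the space to base
points, and path classes from a fixed point to the base points that are compatible with the
contractions. -/
theorem simplyConnectedSpace_of_contractions {ι : Type*} (U : ι → Set X)
    (hU : ∀ i, IsOpen (U i)) (hcov : ∀ x, ∃ i, x ∈ U i) (b : ι → X) (H : ι → X → C(I, X))
    (hH : ∀ i, ContinuousOn (H i) (U i)) (H0 : ∀ i, ∀ x ∈ U i, x = H i x 0)
    (H1 : ∀ i, ∀ x ∈ U i, b i = H i x 1) (x₀ : X)
    (T : ∀ i, Path.Homotopic.Quotient x₀ (b i))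
    (hT : ∀ x, ∃ α : Path.Homotopic.Quotient x₀ x, ∀ i (hx : x ∈ U i),
      α.trans (pathClass (H i x) 0 1 (H0 i x hx) (H1 i x hx)) = T i) :
    SimplyConnectedSpace X := by
  choose α hα using hT
  have square : ∀ i (γ : C(I, X)) (hγ : ∀ u, γ u ∈ U i),
      (α (γ 0)).trans (pathClass γ 0 1 rfl rfl) = α (γ 1) := by
    intro i γ hγ
    have hc : Continuous fun u => H i (γ u) := (hH i).comp_continuous γ.continuous hγ
    let K : C(I × I, X) := ContinuousMap.uncurry ⟨fun u => H i (γ u), hc⟩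
    have hK : ∀ u w, K (u, w) = H i (γ u) w := fun u w => rfl
    have h0 : ∀ u, γ u = K (u, 0) := fun u => H0 i _ (hγ u)
    have h1 : ∀ u, b i = K (u, 1) := fun u => H1 i _ (hγ u)
    have e1 : pathClass γ 0 1 rfl rfl = pathClass K (0, 0) (1, 0) (h0 0) (h0 1) :=
      pathClass_eq_of_comp_eq (f := K) (k := γ) (⟨fun u => (u, 0), by fun_prop⟩ : C(I, I × I))
        (ContinuousMap.ext fun u => (h0 u).symm) rfl rfl rfl rfl (h0 0) (h0 1)
    have e2 : ∀ u, pathClass (H i (γ u)) 0 1 (H0 i _ (hγ u)) (H1 i _ (hγ u)) =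
        pathClass K (u, 0) (u, 1) (h0 u) (h1 u) := fun u =>
      pathClass_eq_of_comp_eq (⟨fun w => (u, w), by fun_prop⟩ : C(I, I × I))
        (ContinuousMap.ext fun w => rfl) rfl rfl _ _ (h0 u) (h1 u)
    -- The far side of the square of contractions is constant, because every contraction ends at `b
    -- i`.
    have e3 : pathClass K (0, 1) (1, 1) (h1 0) (h1 1) = .refl (b i) := by
      refine (pathClass_comp K (⟨fun u => (u, 1), by fun_prop⟩ : C(I, I × I)) (h1 0)
        (h1 1)).symm.trans
        (pathClass_of_const (fun u => (h1 u).symm) _ _)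
    have q0 := hα (γ 0) i (hγ 0)
    have q1 := hα (γ 1) i (hγ 1)
    rw [e2] at q0 q1
    have sq : (pathClass K (0, 0) (1, 0) (h0 0) (h0 1)).trans
        (pathClass K (1, 0) (1, 1) (h0 1) (h1 1)) = pathClass K (0, 0) (0, 1) (h0 0) (h1 0) := by
      rw [pathClass_trans, ← pathClass_trans K (h0 0) (h1 0) (h1 1), e3,
        Path.Homotopic.Quotient.trans_refl]
    rw [e1, ← (show _ = α (γ 1) by
      rw [Path.Homotopic.Quotient.trans_assoc, Path.Homotopic.Quotient.trans_symm,
        Path.Homotopic.Quotient.trans_refl] : ((α (γ 1)).trans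
          (pathClass K (1, 0) (1, 1) (h0 1) (h1 1))).trans
          (pathClass K (1, 0) (1, 1) (h0 1) (h1 1)).symm = α (γ 1)), q1, ← q0, ← sq]
    simp only [Path.Homotopic.Quotient.trans_assoc, Path.Homotopic.Quotient.trans_symm,
        Path.Homotopic.Quotient.trans_refl]
  have main : ∀ γ : C(I, X), (α (γ 0)).trans (pathClass γ 0 1 rfl rfl) = α (γ 1) := by
    intro γ
    -- The class "`α` at `γ s`, then the rest of `γ`" is locally constant in `s` by `square`, hence
    -- constant on the connected interval. Comparing its values at `0` and `1` gives the claim.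
    have hloc : IsLocallyConstant fun s : I =>
        (α (γ s)).trans (pathClass γ s 1 rfl rfl) := by
      rw [IsLocallyConstant.iff_eventually_eq]
      intro s
      obtain ⟨i, hi⟩ := hcov (γ s)
      obtain ⟨ε, hε, hball⟩ := Metric.isOpen_iff.1 ((hU i).preimage γ.continuous) s hi
      filter_upwards [Metric.ball_mem_nhds s hε] with t ht
      let ℓ : C(I, I) := ⟨fun u => ⟨(1 - (u : ℝ)) * s + u * t, by
        have := (convex_Icc (0 : ℝ) 1) s.2 t.2 (by linarith [u.2.2] : 0 ≤ 1 - (u : ℝ)) u.2.1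
          (by ring)
        simpa using this⟩, by fun_prop⟩
      have ℓ0 : ℓ 0 = s := by ext; simp [ℓ]
      have ℓ1 : ℓ 1 = t := by ext; simp [ℓ]
      have hℓ : ∀ u, γ (ℓ u) ∈ U i := by
        intro u
        apply hball
        rw [Metric.mem_ball, Subtype.dist_eq, Real.dist_eq] at ht ⊢
        have : ((ℓ u : I) : ℝ) - s = u * (t - s) := by simp [ℓ]; ring
        rw [this, abs_mul, abs_of_nonneg u.2.1]
        nlinarith [u.2.2, abs_nonneg ((t : ℝ) - s)]
      have key : (α (γ s)).trans (pathClass γ s t rfl rfl) = α (γ t) := by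
        have := square i (γ.comp ℓ) hℓ
        rw [pathClass_comp] at this
        have aux : ∀ s' t', s' = s → t' = t →
            (α (γ s')).trans (pathClass γ s' t' rfl rfl) = α (γ t') →
            (α (γ s)).trans (pathClass γ s t rfl rfl) = α (γ t) := by
          rintro _ _ rfl rfl h
          exact h
        exact aux _ _ ℓ0 ℓ1 this
      rw [← key, Path.Homotopic.Quotient.trans_assoc, pathClass_trans]
    have := hloc.apply_eq_of_preconnectedSpace 0 1
    rw [this, pathClass_self, Path.Homotopic.Quotient.trans_refl]
  have main' : ∀ {x y : X} (p : Path x y), (α x).trans (.mk p) = α y := by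
    intro x y p
    rw [mk_eq_pathClass]
    have key : ∀ {x' y' : X} (hx : x' = p 0) (hy : y' = p 1),
      (α x').trans (pathClass (p : C(I, X)) 0 1 hx hy) = α y' := by
      intro x' y' hx hy
      subst hx hy
      exact main p
    exact key p.source.symm p.target.symm
  rw [simply_connected_iff_paths_homotopic]
  refine ⟨⟨⟨x₀⟩, fun x y => ?_⟩, fun x y => ⟨fun p q => ?_⟩⟩
  · have hx : ∀ z, Joined x₀ z := fun z =>
      ⟨(Path.Homotopic.Quotient.mk_surjective (α z)).choose⟩
    exact (hx x).symm.trans (hx y)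
  · obtain ⟨p, rfl⟩ := Path.Homotopic.Quotient.mk_surjective p
    obtain ⟨q, rfl⟩ := Path.Homotopic.Quotient.mk_surjective q
    -- Both classes equal `(α x)⁻¹` followed by `α y`.
    have h := (main' p).trans (main' q).symm
    have h2 := congrArg (fun z => (α x).symm.trans z) h
    simpa only [← Path.Homotopic.Quotient.trans_assoc, Path.Homotopic.Quotient.symm_trans,
      Path.Homotopic.Quotient.refl_trans] using h2

end PathClasses

/-! ### A polar-coordinate model of `2`-complexes, and its cover by stars and disc interiors. -/

/-- Attaching data for a `2`-complex with `1`-skeleton `Λ`: to each cell is attached a closed edge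
walk, presented as a periodic bi-infinite edge walk. -/
structure AttachingData {V : Type u} (Λ : SimpleGraph V) where
  /-- The set of `2`-cells. -/
  Cell : Type u
  /-- The length of the attaching loop. -/
  len : Cell → ℕ
  /-- The vertices of the attaching loop. -/
  vtx : Cell → ℤ → V
  vtx_add_len : ∀ j m, vtx j (m + len j) = vtx j m
  adj : ∀ j m, Λ.Adj (vtx j m) (vtx j (m + 1))

namespace AttachingData

variable {V : Type u} {Λ : SimpleGraph V} (D : AttachingData Λ)

/-- The edges of the attaching loop. -/
def dart (j : D.Cell) (m : ℤ) : Λ.Dart := ⟨(D.vtx j m, D.vtx j (m + 1)), D.adj j m⟩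

/-- The disjoint union of the cells, the discs being described in polar coordinates, with one unit
of angle for each edge of the attaching loop. -/
abbrev Pieces : Type u :=
  (Σ _ : V, Unit) ⊕ (Σ _ : Λ.Dart, I) ⊕ (Σ _ : D.Cell, I × ℝ)

/-- The point of the `0`-cell `v`. -/
def vert (v : V) : D.Pieces := Sum.inl ⟨v, ()⟩

/-- The point with parameter `t` on the oriented edge `d`. -/
def edge (d : Λ.Dart) (t : I) : D.Pieces := Sum.inr (Sum.inl ⟨d, t⟩)

/-- The point of the disc `j` with polar coordinates `z`. -/
def disc (j : D.Cell) (z : I × ℝ) : D.Pieces := Sum.inr (Sum.inr ⟨j, z⟩)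

theorem Pieces.cases {motive : D.Pieces → Prop} (vert : ∀ v, motive (D.vert v))
    (edge : ∀ d t, motive (D.edge d t)) (disc : ∀ j r x, motive (D.disc j (r, x))) :
    ∀ a, motive a
  | Sum.inl ⟨v, _⟩ => vert v
  | Sum.inr (Sum.inl ⟨d, t⟩) => edge d t
  | Sum.inr (Sum.inr ⟨j, (r, x)⟩) => disc j r x

/-- The gluing of the cells. -/
inductive Glue : D.Pieces → D.Pieces → Prop
  | start (d : Λ.Dart) : Glue (D.edge d 0) (D.vert d.fst)
  | reverse (d : Λ.Dart) (t : I) : Glue (D.edge d t) (D.edge d.symm (σ t))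
  | attach (j : D.Cell) (m : ℤ) (t : I) : Glue (D.disc j (1, m + t)) (D.edge (D.dart j m) t)
  | period (j : D.Cell) (r : I) (x : ℝ) : Glue (D.disc j (r, x + D.len j)) (D.disc j (r, x))
  | center (j : D.Cell) (x y : ℝ) : Glue (D.disc j (0, x)) (D.disc j (0, y))

/-- The `2`-complex defined by the attaching data. -/
def Space : Type u := Quot D.Glue

instance : TopologicalSpace D.Space := inferInstanceAs (TopologicalSpace (Quot D.Glue))

/-- The projection from the disjoint union of the cells. -/
def proj (a : D.Pieces) : D.Space := Quot.mk _ a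

theorem isQuotientMap_proj : IsQuotientMap D.proj := isQuotientMap_quot_mk

theorem continuous_proj : Continuous D.proj := D.isQuotientMap_proj.continuous

theorem continuous_edge (d : Λ.Dart) : Continuous (D.edge d) :=
  continuous_inr.comp (continuous_inl.comp continuous_sigmaMk)

theorem continuous_disc (j : D.Cell) : Continuous (D.disc j) :=
  continuous_inr.comp (continuous_inr.comp continuous_sigmaMk)

theorem isOpenEmbedding_vert (v : V) :
    IsOpenEmbedding fun x : Unit => (Sum.inl ⟨v, x⟩ : D.Pieces) :=
  IsOpenEmbedding.inl.comp (IsOpenEmbedding.sigmaMk (i := v))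

theorem isOpenEmbedding_edge (d : Λ.Dart) : IsOpenEmbedding (D.edge d) :=
  IsOpenEmbedding.inr.comp (IsOpenEmbedding.inl.comp
    (IsOpenEmbedding.sigmaMk (i := d)))

theorem isOpenEmbedding_disc (j : D.Cell) : IsOpenEmbedding (D.disc j) :=
  IsOpenEmbedding.inr.comp (IsOpenEmbedding.inr.comp
    (IsOpenEmbedding.sigmaMk (i := j)))

/-- The vertex `v` as a point of the complex. -/
def vertPt (v : V) : D.Space := D.proj (D.vert v)

/-- The characteristic map of an oriented edge. -/
def edgeMap (d : Λ.Dart) : C(I, D.Space) :=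
  ⟨fun t => D.proj (D.edge d t), D.continuous_proj.comp (D.continuous_edge d)⟩

/-- The characteristic map of a disc, in polar coordinates. -/
def discMap (j : D.Cell) : C(I × ℝ, D.Space) :=
  ⟨fun z => D.proj (D.disc j z), D.continuous_proj.comp (D.continuous_disc j)⟩

@[simp] theorem proj_edge (d : Λ.Dart) (t : I) : D.proj (D.edge d t) = D.edgeMap d t := rfl

@[simp] theorem proj_disc (j : D.Cell) (z : I × ℝ) : D.proj (D.disc j z) = D.discMap j z := rfl

theorem edgeMap_zero (d : Λ.Dart) : D.edgeMap d 0 = D.vertPt d.fst :=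
  Quot.sound (Glue.start d)

theorem edgeMap_symm (d : Λ.Dart) (t : I) : D.edgeMap d.symm (σ t) = D.edgeMap d t :=
  (Quot.sound (Glue.reverse d t)).symm

theorem edgeMap_one (d : Λ.Dart) : D.edgeMap d 1 = D.vertPt d.snd := by
  rw [← edgeMap_symm, unitInterval.symm_one, edgeMap_zero]
  rfl

theorem discMap_one (j : D.Cell) (m : ℤ) (t : I) :
    D.discMap j (1, m + t) = D.edgeMap (D.dart j m) t :=
  Quot.sound (Glue.attach j m t)

theorem discMap_one_int (j : D.Cell) (m : ℤ) : D.discMap j (1, m) = D.vertPt (D.vtx j m) := by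
  have := D.discMap_one j m 0
  rwa [edgeMap_zero, Set.Icc.coe_zero, add_zero] at this

theorem discMap_add_len (j : D.Cell) (r : I) (x : ℝ) :
    D.discMap j (r, x + D.len j) = D.discMap j (r, x) :=
  Quot.sound (Glue.period j r x)

theorem discMap_zero (j : D.Cell) (x y : ℝ) : D.discMap j (0, x) = D.discMap j (0, y) :=
  Quot.sound (Glue.center j x y)

/-- The open star of a vertex, in the disjoint union of the cells. -/
def star (v : V) : Set D.Pieces :=
  Set.ofPred <| Sum.elim (fun w => w.1 = v) <| Sum.elim
    (fun e => (e.1.fst = v ∧ e.2 < 1) ∨ (e.1.snd = v ∧ 0 < e.2))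
    (fun p => 0 < p.2.1 ∧ ∃ m : ℤ, D.vtx p.1 m = v ∧ |p.2.2 - m| < 1)

theorem vert_mem_star {v w : V} : D.vert w ∈ D.star v ↔ w = v := Iff.rfl

theorem edge_mem_star {v : V} {d : Λ.Dart} {t : I} :
    D.edge d t ∈ D.star v ↔ (d.fst = v ∧ t < 1) ∨ (d.snd = v ∧ 0 < t) := Iff.rfl

theorem disc_mem_star {v : V} {j : D.Cell} {r : I} {x : ℝ} :
    D.disc j (r, x) ∈ D.star v ↔ 0 < r ∧ ∃ m : ℤ, D.vtx j m = v ∧ |x - m| < 1 := Iff.rfl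

/-- The interior of a disc, in the disjoint union of the cells. -/
def inner (j : D.Cell) : Set D.Pieces :=
  Set.ofPred <| Sum.elim (fun _ => False) <| Sum.elim (fun _ => False)
    (fun p => p.1 = j ∧ p.2.1 < 1)

theorem vert_notMem_inner {v : V} {j : D.Cell} : D.vert v ∉ D.inner j := id

theorem edge_notMem_inner {d : Λ.Dart} {t : I} {j : D.Cell} : D.edge d t ∉ D.inner j := id

theorem disc_mem_inner {j k : D.Cell} {z : I × ℝ} : D.disc k z ∈ D.inner j ↔ k = j ∧ z.1 < 1 :=
  Iff.rfl

/-- The cover of the disjoint union of the cells by the open stars of the vertices and the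
interiors of the discs. -/
def nbhd : V ⊕ D.Cell → Set D.Pieces := Sum.elim D.star D.inner

/-- Two integers at distance less than one from the same real differ by at most one, and consecutive
vertices of an edge walk are distinct because the graph has no loops. -/
theorem corner_unique {j : D.Cell} {v : V} {x : ℝ} {m k : ℤ} (hm : D.vtx j m = v)
    (hmx : |x - m| < 1) (hk : D.vtx j k = v) (hkx : |x - k| < 1) : m = k := by
  rw [abs_lt] at hmx hkx
  have h1 : m < k + 2 := by
    have : (m : ℝ) < (k + 2 : ℤ) := by push_cast; linarith
    exact_mod_cast this
  have h2 : k < m + 2 := by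
    have : (k : ℝ) < (m + 2 : ℤ) := by push_cast; linarith
    exact_mod_cast this
  obtain h | h | h : m = k ∨ k = m + 1 ∨ m = k + 1 := by omega
  · exact h
  · subst h
    exact absurd (hm.trans hk.symm) (D.adj j m).ne
  · subst h
    exact absurd (hk.trans hm.symm) (D.adj j k).ne

open Classical in
/-- The corner of the disc `j` at the vertex `v` that is closest to the angle `x`. -/
noncomputable def corner (j : D.Cell) (v : V) (x : ℝ) : ℤ :=
  if h : ∃ m : ℤ, D.vtx j m = v ∧ |x - m| < 1 then h.choose else 0

theorem corner_eq {j : D.Cell} {v : V} {x : ℝ} {m : ℤ} (hm : D.vtx j m = v)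
    (hx : |x - m| < 1) : D.corner j v x = m := by
  have h : ∃ m : ℤ, D.vtx j m = v ∧ |x - m| < 1 := ⟨m, hm, hx⟩
  rw [corner, dif_pos h]
  exact D.corner_unique h.choose_spec.1 h.choose_spec.2 hm hx

theorem corner_eventually {j : D.Cell} {v : V} {x : ℝ} {m : ℤ} (hm : D.vtx j m = v)
    (hx : |x - m| < 1) : ∀ᶠ y in 𝓝 x, D.corner j v y = m := by
  have : IsOpen {y : ℝ | |y - m| < 1} := isOpen_lt (by fun_prop) continuous_const
  filter_upwards [this.mem_nhds hx] with y hy using D.corner_eq hm hy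

theorem attach_mem_star {m k : ℤ} {t : I} (h : |(m : ℝ) + t - k| < 1) :
    (k = m ∧ t < 1) ∨ (k = m + 1 ∧ 0 < t) := by
  rw [abs_lt] at h
  have h1 : k < m + 2 := by
    have : (k : ℝ) < (m + 2 : ℤ) := by push_cast; linarith [t.2.2]
    exact_mod_cast this
  have h2 : m < k + 1 := by
    have : (m : ℝ) < (k + 1 : ℤ) := by push_cast; linarith [t.2.1]
    exact_mod_cast this
  obtain h' | h' : k = m ∨ k = m + 1 := by omega
  · subst h'
    exact Or.inl ⟨rfl, Subtype.coe_lt_coe.1 (by simpa using h.2)⟩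
  · subst h'
    push_cast at h
    exact Or.inr ⟨rfl, Subtype.coe_lt_coe.1 (by simpa using h.1)⟩

variable {D}

/-- Stars are saturated for the gluing, so they descend to open subsets of the complex. -/
theorem Glue.mem_star_iff {a b : D.Pieces} (h : D.Glue a b) (v : V) :
    a ∈ D.star v ↔ b ∈ D.star v := by
  induction h with
  | start d => simp [edge_mem_star, vert_mem_star]
  | reverse d t =>
    simp only [edge_mem_star, SimpleGraph.Dart.symm_toProd,
      Prod.fst_swap, Prod.snd_swap]
    rw [or_comm]
    refine or_congr (and_congr Iff.rfl ?_) (and_congr Iff.rfl ?_)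
    · rw [← Subtype.coe_lt_coe, ← Subtype.coe_lt_coe, unitInterval.coe_symm_eq]
      simp
    · rw [← Subtype.coe_lt_coe, ← Subtype.coe_lt_coe, unitInterval.coe_symm_eq]
      simp
  | attach j m t =>
    rw [disc_mem_star, edge_mem_star]
    constructor
    · rintro ⟨-, k, hk, hx⟩
      obtain ⟨rfl, ht⟩ | ⟨rfl, ht⟩ := attach_mem_star hx
      · exact Or.inl ⟨hk, ht⟩
      · exact Or.inr ⟨hk, ht⟩
    · rintro (⟨hk, ht⟩ | ⟨hk, ht⟩)
      · refine ⟨zero_lt_one, m, hk, ?_⟩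
        have : (t : ℝ) < 1 := ht
        rw [abs_lt]
        constructor <;> linarith [t.2.1]
      · refine ⟨zero_lt_one, m + 1, hk, ?_⟩
        have : 0 < (t : ℝ) := ht
        push_cast
        rw [abs_lt]
        constructor <;> linarith [t.2.2]
  | period j r x =>
    rw [disc_mem_star, disc_mem_star]
    refine and_congr Iff.rfl ⟨?_, ?_⟩
    · rintro ⟨m, hm, hx⟩
      refine ⟨m - D.len j, ?_, ?_⟩
      · rw [← hm, ← D.vtx_add_len, sub_add_cancel]
      · push_cast
        rwa [← sub_add, sub_add_eq_add_sub]
    · rintro ⟨m, hm, hx⟩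
      refine ⟨m + D.len j, ?_, ?_⟩
      · rw [← hm, D.vtx_add_len]
      · push_cast
        rwa [add_sub_add_right_eq_sub]
  | center j x y => simp [disc_mem_star]

theorem Glue.mem_inner_iff {a b : D.Pieces} (h : D.Glue a b) (j : D.Cell) :
    a ∈ D.inner j ↔ b ∈ D.inner j := by
  induction h with
  | start d => simp [edge_notMem_inner, vert_notMem_inner]
  | reverse d t => simp [edge_notMem_inner]
  | attach j m t => simp [edge_notMem_inner, disc_mem_inner]
  | period j r x => simp [disc_mem_inner]
  | center j x y => simp [disc_mem_inner]

theorem Glue.mem_nbhd_iff {a b : D.Pieces} (h : D.Glue a b) (i : V ⊕ D.Cell) :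
    a ∈ D.nbhd i ↔ b ∈ D.nbhd i :=
  match i with
  | Sum.inl v => h.mem_star_iff v
  | Sum.inr j => h.mem_inner_iff j

variable (D)

theorem isOpen_star (v : V) : IsOpen (D.star v) := by
  refine isOpen_sum_iff.2 ⟨isOpen_sigma_iff.2 fun _ => isOpen_discrete _,
    isOpen_sum_iff.2 ⟨isOpen_sigma_iff.2 fun d => ?_, isOpen_sigma_iff.2 fun j => ?_⟩⟩
  · change IsOpen {t : I | (d.fst = v ∧ t < 1) ∨ (d.snd = v ∧ 0 < t)}
    exact IsOpen.union (isOpen_const.and (isOpen_lt continuous_id continuous_const))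
      (isOpen_const.and (isOpen_lt continuous_const continuous_id))
  · change IsOpen {z : I × ℝ | 0 < z.1 ∧ ∃ m : ℤ, D.vtx j m = v ∧ |z.2 - m| < 1}
    refine (isOpen_lt continuous_const continuous_fst).and ?_
    rw [Set.ofPred_exists]
    exact isOpen_iUnion fun m => isOpen_const.and (isOpen_lt (by fun_prop) continuous_const)

theorem isOpen_inner (j : D.Cell) : IsOpen (D.inner j) := by
  refine isOpen_sum_iff.2 ⟨isOpen_const (p := False),
    isOpen_sum_iff.2 ⟨isOpen_const (p := False), isOpen_sigma_iff.2 fun k => ?_⟩⟩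
  change IsOpen {z : I × ℝ | k = j ∧ z.1 < 1}
  exact isOpen_const.and (isOpen_lt continuous_fst continuous_const)

theorem isOpen_nbhd : ∀ i, IsOpen (D.nbhd i)
  | Sum.inl v => D.isOpen_star v
  | Sum.inr j => D.isOpen_inner j

theorem exists_mem_nbhd (a : D.Pieces) : ∃ i, a ∈ D.nbhd i := by
  induction a using Pieces.cases with
  | vert v => exact ⟨Sum.inl v, rfl⟩
  | edge d t =>
    obtain h | h := lt_or_ge t 1
    · exact ⟨Sum.inl d.fst, Or.inl ⟨rfl, h⟩⟩
    · exact ⟨Sum.inl d.snd, Or.inr ⟨rfl, zero_lt_one.trans_le h⟩⟩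
  | disc j r x =>
    obtain h | h := lt_or_ge r 1
    · exact ⟨Sum.inr j, rfl, h⟩
    · refine ⟨Sum.inl (D.vtx j ⌊x⌋), zero_lt_one.trans_le h, ⌊x⌋, rfl, ?_⟩
      rw [abs_lt]
      constructor <;> linarith [Int.floor_le x, Int.lt_floor_add_one x]

/-- To be continuous on one of the sets of the cover, it suffices to be continuous in each cell. -/
theorem continuousOn_nbhd {Z : Type*} [TopologicalSpace Z] {i : V ⊕ D.Cell} {f : D.Pieces → Z}
    (hedge : ∀ d t, D.edge d t ∈ D.nbhd i → ContinuousAt (fun s => f (D.edge d s)) t)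
    (hdisc : ∀ j z, D.disc j z ∈ D.nbhd i → ContinuousAt (fun w => f (D.disc j w)) z) :
    ContinuousOn f (D.nbhd i) := by
  intro a ha
  apply ContinuousAt.continuousWithinAt
  induction a using Pieces.cases with
  | vert v =>
    exact ((D.isOpenEmbedding_vert v).continuousAt_iff (x := ())).1 continuousAt_const
  | edge d t => exact (D.isOpenEmbedding_edge d).continuousAt_iff.1 (hedge d t ha)
  | disc j r x => exact (D.isOpenEmbedding_disc j).continuousAt_iff.1 (hdisc j _ ha)

end AttachingData

/-! ### Contractions of the stars and disc interiors, and their descent to the complex. -/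

namespace AttachingData

variable {V : Type u} {Λ : SimpleGraph V} (D : AttachingData Λ)

section Contraction

/-- The contraction of an oriented edge to its first vertex. -/
def edgeToFst (d : Λ.Dart) : C(I, C(I, D.Space)) :=
  ContinuousMap.curry ((D.edgeMap d).comp ⟨fun p : I × I => p.1 * σ p.2, by fun_prop⟩)

/-- The contraction of an oriented edge to its second vertex. -/
def edgeToSnd (d : Λ.Dart) : C(I, C(I, D.Space)) :=
  ContinuousMap.curry ((D.edgeMap d).comp ⟨fun p : I × I => σ (σ p.1 * σ p.2), by fun_prop⟩)

/-- The contraction of a disc, minus its center, to a corner. -/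
def discToCorner (j : D.Cell) (m : ℤ) : C(I × ℝ, C(I, D.Space)) :=
  ContinuousMap.curry ((D.discMap j).comp
    ⟨fun p : (I × ℝ) × I => (σ (σ p.1.1 * σ p.2), p.1.2 + p.2 * (m - p.1.2)), by fun_prop⟩)

/-- The contraction of a disc to its center. -/
def discToCenter (j : D.Cell) : C(I × ℝ, C(I, D.Space)) :=
  ContinuousMap.curry ((D.discMap j).comp
    ⟨fun p : (I × ℝ) × I => (p.1.1 * σ p.2, p.1.2), by fun_prop⟩)

theorem edgeToFst_apply (d : Λ.Dart) (t u : I) : D.edgeToFst d t u = D.edgeMap d (t * σ u) := rfl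

theorem edgeToSnd_apply (d : Λ.Dart) (t u : I) :
    D.edgeToSnd d t u = D.edgeMap d (σ (σ t * σ u)) := rfl

theorem discToCorner_apply (j : D.Cell) (m : ℤ) (r : I) (x : ℝ) (u : I) :
    D.discToCorner j m (r, x) u = D.discMap j (σ (σ r * σ u), x + u * (m - x)) := rfl

theorem discToCenter_apply (j : D.Cell) (r : I) (x : ℝ) (u : I) :
    D.discToCenter j (r, x) u = D.discMap j (r * σ u, x) := rfl

open Classical in
/-- The contraction of the open star of a vertex to that vertex. -/
noncomputable def contrStar (v : V) : D.Pieces → C(I, D.Space) :=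
  Sum.elim (fun w => ContinuousMap.const I (D.vertPt w.1)) <| Sum.elim
    (fun e => if e.1.fst = v then D.edgeToFst e.1 e.2 else D.edgeToSnd e.1 e.2)
    (fun p => D.discToCorner p.1 (D.corner p.1 v p.2.2) p.2)

theorem contrStar_vert (v w : V) :
    D.contrStar v (D.vert w) = ContinuousMap.const I (D.vertPt w) := rfl

theorem contrStar_edge_fst {v : V} {d : Λ.Dart} (h : d.fst = v) (t : I) :
    D.contrStar v (D.edge d t) = D.edgeToFst d t := if_pos h

theorem contrStar_edge_snd {v : V} {d : Λ.Dart} (h : d.snd = v) (t : I) :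
    D.contrStar v (D.edge d t) = D.edgeToSnd d t :=
  if_neg fun h' => d.adj.ne (h'.trans h.symm)

theorem contrStar_disc {v : V} {j : D.Cell} {m : ℤ} {r : I} {x : ℝ} (hm : D.vtx j m = v)
    (hx : |x - m| < 1) : D.contrStar v (D.disc j (r, x)) = D.discToCorner j m (r, x) := by
  change D.discToCorner j (D.corner j v x) (r, x) = _
  rw [D.corner_eq hm hx]

/-- The contraction of the interior of a disc to its center. -/
def contrInner : D.Pieces → C(I, D.Space) :=
  Sum.elim (fun w => ContinuousMap.const I (D.vertPt w.1)) <| Sum.elim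
    (fun e => D.edgeToFst e.1 e.2) (fun p => D.discToCenter p.1 p.2)

theorem contrInner_disc (j : D.Cell) (z : I × ℝ) :
    D.contrInner (D.disc j z) = D.discToCenter j z := rfl

/-- The contractions of the sets of the cover `AttachingData.nbhd`. -/
noncomputable def contr : V ⊕ D.Cell → D.Pieces → C(I, D.Space) :=
  Sum.elim D.contrStar fun _ => D.contrInner

variable {D}

/-- At radius one the disc contraction keeps the radius and moves the angle linearly to the corner,
which is the contraction of the boundary edge. The identification of center points causes no
conflict, since a star omits the centers. -/
theorem Glue.contrStar_eq {a b : D.Pieces} (h : D.Glue a b) {v : V} (ha : a ∈ D.star v) :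
    D.contrStar v a = D.contrStar v b := by
  induction h with
  | start d =>
    have hd : d.fst = v := by simpa [edge_mem_star] using ha
    rw [contrStar_edge_fst D hd, contrStar_vert]
    ext u
    rw [edgeToFst_apply, zero_mul, edgeMap_zero]
    rfl
  | reverse d t =>
    obtain ⟨hd, -⟩ | ⟨hd, -⟩ := ha
    · rw [contrStar_edge_fst D hd, contrStar_edge_snd D (d := d.symm) hd]
      ext u
      rw [edgeToFst_apply, edgeToSnd_apply, unitInterval.symm_symm, edgeMap_symm]
    · rw [contrStar_edge_snd D hd, contrStar_edge_fst D (d := d.symm) hd]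
      ext u
      rw [edgeToFst_apply, edgeToSnd_apply, ← edgeMap_symm, unitInterval.symm_symm]
  | attach j m t =>
    obtain ⟨-, k, hk, hx⟩ := ha
    rw [contrStar_disc D hk hx]
    obtain ⟨rfl, ht⟩ | ⟨rfl, ht⟩ := attach_mem_star hx
    · rw [contrStar_edge_fst D (d := D.dart j k) hk]
      ext u
      rw [discToCorner_apply, edgeToFst_apply, ← discMap_one]
      simp only [unitInterval.symm_one, zero_mul, unitInterval.symm_zero, Set.Icc.coe_mul,
        unitInterval.coe_symm_eq]
      congr 2
      ring
    · rw [contrStar_edge_snd D (d := D.dart j m) hk]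
      ext u
      rw [discToCorner_apply, edgeToSnd_apply, ← discMap_one]
      simp only [unitInterval.symm_one, zero_mul, unitInterval.symm_zero, Set.Icc.coe_mul,
        unitInterval.coe_symm_eq]
      congr 2
      push_cast
      ring
  | period j r x =>
    obtain ⟨-, k, hk, hx⟩ := (Glue.period j r x).mem_star_iff v |>.1 ha
    rw [contrStar_disc D hk hx, contrStar_disc D (m := k + D.len j)
      (by rw [D.vtx_add_len, hk]) (by push_cast; rwa [add_sub_add_right_eq_sub])]
    ext u
    rw [discToCorner_apply, discToCorner_apply, ← D.discMap_add_len j _ (x + u * (k - x))]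
    congr 2
    push_cast
    ring
  | center j x y => exact absurd ha.1 (lt_irrefl _)

theorem Glue.contrInner_eq {a b : D.Pieces} (h : D.Glue a b) {j : D.Cell} (ha : a ∈ D.inner j) :
    D.contrInner a = D.contrInner b := by
  induction h with
  | start d => exact ha.elim
  | reverse d t => exact ha.elim
  | attach j m t => exact absurd ha.2 (lt_irrefl _)
  | period j r x =>
    rw [contrInner_disc, contrInner_disc]
    ext u
    rw [discToCenter_apply, discToCenter_apply, D.discMap_add_len]
  | center j x y =>
    rw [contrInner_disc, contrInner_disc]
    ext u
    rw [discToCenter_apply, discToCenter_apply, zero_mul, D.discMap_zero]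

theorem Glue.contr_eq {a b : D.Pieces} (h : D.Glue a b) {i : V ⊕ D.Cell} (ha : a ∈ D.nbhd i) :
    D.contr i a = D.contr i b :=
  match i with
  | Sum.inl _ => h.contrStar_eq ha
  | Sum.inr _ => h.contrInner_eq ha

variable (D)

theorem continuousOn_contr (i : V ⊕ D.Cell) : ContinuousOn (D.contr i) (D.nbhd i) := by
  refine D.continuousOn_nbhd (fun d t ht => ?_) (fun j z hz => ?_)
  · obtain v | j := i
    · change ContinuousAt (fun s => D.contrStar v (D.edge d s)) t
      obtain ⟨hd, -⟩ | ⟨hd, -⟩ := ht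
      · simp only [contrStar_edge_fst D hd]
        exact (D.edgeToFst d).continuous.continuousAt
      · simp only [contrStar_edge_snd D hd]
        exact (D.edgeToSnd d).continuous.continuousAt
    · exact ht.elim
  · obtain v | k := i
    · obtain ⟨-, m, hm, hx⟩ := hz
      refine ((D.discToCorner j m).continuous.continuousAt (x := z)).congr ?_
      filter_upwards [continuous_snd.continuousAt.eventually (D.corner_eventually hm hx)] with w hw
      change _ = D.discToCorner j (D.corner j v w.2) w
      rw [hw]
    · exact (D.discToCenter j).continuous.continuousAt

/-- The base points of the contractions. -/
def base : V ⊕ D.Cell → D.Space := Sum.elim D.vertPt fun j => D.discMap j (0, 0)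

theorem proj_eq_contr_zero {i : V ⊕ D.Cell} {a : D.Pieces} (ha : a ∈ D.nbhd i) :
    D.proj a = D.contr i a 0 := by
  obtain v | k := i
  · change _ = D.contrStar v a 0
    induction a using Pieces.cases with
    | vert w => rfl
    | edge d t =>
      obtain ⟨hd, -⟩ | ⟨hd, -⟩ := ha
      · rw [contrStar_edge_fst D hd, edgeToFst_apply]
        simp
      · rw [contrStar_edge_snd D hd, edgeToSnd_apply]
        simp
    | disc j r x =>
      obtain ⟨-, m, hm, hx⟩ := ha
      rw [contrStar_disc D hm hx, discToCorner_apply]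
      simp
  · change _ = D.contrInner a 0
    induction a using Pieces.cases with
    | vert w => exact ha.elim
    | edge d t => exact ha.elim
    | disc j r x =>
      rw [contrInner_disc, discToCenter_apply]
      simp

theorem base_eq_contr_one {i : V ⊕ D.Cell} {a : D.Pieces} (ha : a ∈ D.nbhd i) :
    D.base i = D.contr i a 1 := by
  obtain v | k := i
  · change D.vertPt v = D.contrStar v a 1
    induction a using Pieces.cases with
    | vert w =>
      obtain rfl : w = v := ha
      rfl
    | edge d t =>
      obtain ⟨hd, -⟩ | ⟨hd, -⟩ := ha
      · rw [contrStar_edge_fst D hd, edgeToFst_apply]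
        simpa [edgeMap_zero] using congrArg D.vertPt hd.symm
      · rw [contrStar_edge_snd D hd, edgeToSnd_apply]
        simpa [edgeMap_one] using congrArg D.vertPt hd.symm
    | disc j r x =>
      obtain ⟨-, m, hm, hx⟩ := ha
      rw [contrStar_disc D hm hx, discToCorner_apply]
      simp [discMap_one_int, hm]
  · change D.discMap k (0, 0) = D.contrInner a 1
    induction a using Pieces.cases with
    | vert w => exact ha.elim
    | edge d t => exact ha.elim
    | disc j r x =>
      obtain rfl : j = k := ha.1
      rw [contrInner_disc, discToCenter_apply]
      simpa using D.discMap_zero j 0 x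

/-- The image of a set of the cover in the complex. -/
def chart (i : V ⊕ D.Cell) : Set D.Space := D.proj '' D.nbhd i

theorem proj_mem_chart {i : V ⊕ D.Cell} {a : D.Pieces} : D.proj a ∈ D.chart i ↔ a ∈ D.nbhd i := by
  refine ⟨?_, fun h => ⟨a, h, rfl⟩⟩
  rintro ⟨b, hb, hba⟩
  have : ∀ {a b : D.Pieces}, Relation.EqvGen D.Glue a b → (a ∈ D.nbhd i ↔ b ∈ D.nbhd i) := by
    intro a b h
    induction h with
    | rel a b h => exact h.mem_nbhd_iff i
    | refl a => exact Iff.rfl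
    | symm a b _ ih => exact ih.symm
    | trans a b c _ _ ih1 ih2 => exact ih1.trans ih2
  exact (this (Quot.eqvGen_exact hba)).1 hb

theorem isOpen_chart (i : V ⊕ D.Cell) : IsOpen (D.chart i) := by
  rw [← D.isQuotientMap_proj.isOpen_preimage]
  convert D.isOpen_nbhd i using 1
  ext a
  exact D.proj_mem_chart

theorem exists_mem_chart (x : D.Space) : ∃ i, x ∈ D.chart i := by
  obtain ⟨a, rfl⟩ := D.isQuotientMap_proj.surjective x
  obtain ⟨i, hi⟩ := D.exists_mem_nbhd a
  exact ⟨i, a, hi, rfl⟩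

open Classical in
/-- The contraction of a chart in the complex. -/
noncomputable def chartContr (i : V ⊕ D.Cell) : D.Space → C(I, D.Space) :=
  -- The constant path outside the chart is a dummy value that respects the gluing; continuity is
  -- only claimed on the chart.
  Quot.lift (fun a => if a ∈ D.nbhd i then D.contr i a else ContinuousMap.const I (D.proj a))
    fun a b h => by
      by_cases ha : a ∈ D.nbhd i
      · rw [if_pos ha, if_pos ((h.mem_nbhd_iff i).1 ha), h.contr_eq ha]
      · rw [if_neg ha, if_neg fun hb => ha ((h.mem_nbhd_iff i).2 hb)]
        congr 1
        exact Quot.sound h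

theorem chartContr_proj {i : V ⊕ D.Cell} {a : D.Pieces} (ha : a ∈ D.nbhd i) :
    D.chartContr i (D.proj a) = D.contr i a := if_pos ha

theorem continuousOn_chartContr (i : V ⊕ D.Cell) :
    ContinuousOn (D.chartContr i) (D.chart i) := by
  rw [D.isQuotientMap_proj.continuousOn_isOpen_iff (D.isOpen_chart i)]
  have : D.proj ⁻¹' D.chart i = D.nbhd i := Set.ext fun a => D.proj_mem_chart
  rw [this]
  exact (D.continuousOn_contr i).congr fun a ha => D.chartContr_proj ha

end Contraction

end AttachingData

/-! ### Algebra of path classes. -/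

/-- The group of homotopy classes of loops at `x`, multiplied in the order of concatenation. -/
def LoopClass (X : Type*) [TopologicalSpace X] (x : X) : Type _ := Path.Homotopic.Quotient x x

noncomputable instance (X : Type*) [TopologicalSpace X] (x : X) : Group (LoopClass X x) where
  mul := Path.Homotopic.Quotient.trans
  one := Path.Homotopic.Quotient.refl x
  inv := Path.Homotopic.Quotient.symm
  mul_assoc := trans_assoc
  one_mul := refl_trans
  mul_one := trans_refl
  inv_mul_cancel := symm_trans

section PathAlgebra

variable {X : Type*} [TopologicalSpace X] {x y z : X}

theorem trans_right_injective (p : Path.Homotopic.Quotient y z) :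
    Function.Injective fun q : Path.Homotopic.Quotient x y => q.trans p := by
  intro q r h
  have := congrArg (fun s => Path.Homotopic.Quotient.trans s p.symm) h
  simpa only [trans_assoc, trans_symm, trans_refl] using this

theorem trans_left_injective (p : Path.Homotopic.Quotient x y) :
    Function.Injective fun q : Path.Homotopic.Quotient y z => p.trans q := by
  intro q r h
  have := congrArg (fun s => p.symm.trans s) h
  simpa only [← trans_assoc, symm_trans, refl_trans] using this

theorem symm_trans_rev (p : Path.Homotopic.Quotient x y) (q : Path.Homotopic.Quotient y z) :
    (p.trans q).symm = q.symm.trans p.symm := by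
  apply trans_left_injective (p.trans q)
  change (p.trans q).trans (p.trans q).symm = (p.trans q).trans (q.symm.trans p.symm)
  rw [trans_symm, trans_assoc, ← trans_assoc q, trans_symm, refl_trans, trans_symm]

theorem symm_symm_quotient (p : Path.Homotopic.Quotient x y) : p.symm.symm = p := by
  apply trans_left_injective p.symm
  change p.symm.trans p.symm.symm = p.symm.trans p
  rw [trans_symm, symm_trans]

/-- The loop that goes out along `a`, follows `e` and comes back along `b`. -/
noncomputable def LoopClass.conj {w : X} (a : Path.Homotopic.Quotient w x)
    (e : Path.Homotopic.Quotient x y) (b : Path.Homotopic.Quotient w y) : LoopClass X w :=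
  (a.trans e).trans b.symm

theorem LoopClass.conj_inv {w : X} (a : Path.Homotopic.Quotient w x)
    (e : Path.Homotopic.Quotient x y) (b : Path.Homotopic.Quotient w y) :
    (conj a e b)⁻¹ = conj b e.symm a := by
  change ((a.trans e).trans b.symm).symm = (b.trans e.symm).trans a.symm
  rw [symm_trans_rev, symm_trans_rev, symm_symm_quotient, trans_assoc]

theorem LoopClass.conj_mul_conj {w : X} (s : Path.Homotopic.Quotient w x)
    (p : Path.Homotopic.Quotient x y) (a : Path.Homotopic.Quotient w y)
    (e : Path.Homotopic.Quotient y z) (b : Path.Homotopic.Quotient w z) :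
    conj s p a * conj a e b = conj s (p.trans e) b := by
  change ((s.trans p).trans a.symm).trans ((a.trans e).trans b.symm) =
    (s.trans (p.trans e)).trans b.symm
  simp only [trans_assoc]
  rw [← trans_assoc a.symm, symm_trans, refl_trans]

theorem LoopClass.trans_eq_of_conj_eq {w : X} {a : Path.Homotopic.Quotient w x}
    {e : Path.Homotopic.Quotient x y} {b : Path.Homotopic.Quotient w y} {f g : LoopClass X w}
    (h : conj a e b = f⁻¹ * g) :
    (Path.Homotopic.Quotient.trans f a).trans e = Path.Homotopic.Quotient.trans g b := by
  rw [eq_inv_mul_iff_mul_eq] at h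
  subst h
  have key : ∀ q : Path.Homotopic.Quotient w w,
      (q.trans a).trans e = (q.trans ((a.trans e).trans b.symm)).trans b := by
    intro q
    simp only [trans_assoc]
    rw [symm_trans, trans_refl]
  exact key f

/-- Extending a path in the image of a simply connected space. -/
theorem trans_pathClass_trans {Y Z : Type*} [TopologicalSpace Y] [TopologicalSpace Z]
    [SimplyConnectedSpace Y] [SimplyConnectedSpace Z] {w : X} (α : Path.Homotopic.Quotient w x)
    {f : C(Y, X)} {k : C(Z, X)} (g : C(Z, Y)) (h : f.comp g = k) {a b c : Y} {b' c' : Z}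
    (hb : g b' = b) (hc : g c' = c) (hx : x = f a) (hy : y = f b) (hy' : y = k b') (hz : z = f c)
    (hz' : z = k c') :
    (α.trans (pathClass f a b hx hy)).trans (pathClass k b' c' hy' hz') =
      α.trans (pathClass f a c hx hz) := by
  rw [pathClass_eq_of_comp_eq g h hb hc hy' hz' hy hz, trans_assoc, pathClass_trans]

end PathAlgebra

/-! ### Flat labellings, and simple connectivity from the existence of potentials. -/

namespace AttachingData

variable {V : Type u} {Λ : SimpleGraph V} (D : AttachingData Λ)

/-- A labelling of the edges is flat if its product around the boundary of each disc is trivial. -/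
def Flat {Q : Type*} [Group Q] (c : V → V → Q) : Prop :=
  ∃ h : D.Cell → ℤ → Q, ∀ j m,
    h j (m + 1) = h j m * c (D.vtx j m) (D.vtx j (m + 1)) ∧ h j (m + D.len j) = h j m

/-- The class of an oriented edge. -/
noncomputable def edgeClass (d : Λ.Dart) :
    Path.Homotopic.Quotient (D.vertPt d.fst) (D.vertPt d.snd) :=
  pathClass (D.edgeMap d) 0 1 (D.edgeMap_zero d).symm (D.edgeMap_one d).symm

theorem edgeClass_symm (d : Λ.Dart) : D.edgeClass d.symm = (D.edgeClass d).symm := by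
  rw [edgeClass, edgeClass, pathClass_symm]
  exact pathClass_eq_of_comp_eq (f := D.edgeMap d) (k := D.edgeMap d.symm) ⟨σ, by fun_prop⟩
    (ContinuousMap.ext fun t => by
      rw [← D.edgeMap_symm d.symm t]
      rfl) (by simp) (by simp) _ _ _ _

/-- The class of the path from the center of a disc to a point of its boundary. -/
noncomputable def spoke (j : D.Cell) (m : ℤ) {y : D.Space} (hy : y = D.discMap j (1, m)) :
    Path.Homotopic.Quotient (D.discMap j (0, 0)) y :=
  pathClass (D.discMap j) (0, 0) (1, m) rfl hy

/-- All the paths involved come from the simply connected strip `I × ℝ`, so only their endpoints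
there matter. -/
theorem spoke_trans_edgeClass (j : D.Cell) (m : ℤ) :
    (D.spoke j m (D.discMap_one_int j m).symm).trans (D.edgeClass (D.dart j m)) =
      D.spoke j (m + 1) (D.discMap_one_int j (m + 1)).symm := by
  have : D.edgeClass (D.dart j m) = pathClass (D.discMap j) (1, (m : ℝ)) (1, ((m + 1 : ℤ) : ℝ))
      (D.discMap_one_int j m).symm (D.discMap_one_int j (m + 1)).symm :=
    pathClass_eq_of_comp_eq (f := D.discMap j) (k := D.edgeMap (D.dart j m))
      ⟨fun t : I => (1, (m : ℝ) + t), by fun_prop⟩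
      (ContinuousMap.ext fun t => D.discMap_one j m t) (by simp) (by simp) _ _ _ _
  exact (congrArg (D.spoke j m _).trans this).trans (pathClass_trans _ _ _ _)

theorem pathClass_discMap_zero (j : D.Cell) (x y : ℝ) {z : D.Space}
    (hx : z = D.discMap j (0, x)) (hy : z = D.discMap j (0, y)) :
    pathClass (D.discMap j) (0, x) (0, y) hx hy = .refl z :=
  (pathClass_comp (D.discMap j) ⟨fun y : ℝ => ((0 : I), y), by fun_prop⟩ hx hy).symm.trans
    (pathClass_of_const (x := D.discMap j (0, 0)) (fun _ => D.discMap_zero j _ _) _ _)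

/-- Translating the angle by a full turn preserves the disc map and moves the start of the spoke
only within radius zero, where the disc map is constant. -/
theorem spoke_add_len (j : D.Cell) (m : ℤ) {y : D.Space}
    (hy : y = D.discMap j (1, ((m + D.len j : ℤ) : ℝ))) (hy' : y = D.discMap j (1, m)) :
    D.spoke j (m + D.len j) hy = D.spoke j m hy' := by
  have h0 : D.discMap j (0, 0) = D.discMap j (0, (D.len j : ℝ)) := D.discMap_zero j _ _
  rw [spoke, spoke, ← pathClass_trans (D.discMap j) rfl h0 hy,
    pathClass_discMap_zero, refl_trans]
  refine (pathClass_eq_of_comp_eq (f := D.discMap j) (k := D.discMap j)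
    ⟨fun z : I × ℝ => (z.1, z.2 + D.len j), by fun_prop⟩
    (ContinuousMap.ext fun z => D.discMap_add_len j z.1 z.2) (by simp) (by simp) _ _ _ _).symm

/-- If the graph is connected, any two vertices are joined in the complex. -/
theorem joined_vertPt (hΛ : Λ.Connected) (v w : V) : Joined (D.vertPt v) (D.vertPt w) := by
  obtain ⟨p⟩ := hΛ.preconnected v w
  induction p with
  | nil => exact Joined.refl _
  | cons h p ih =>
    refine Joined.trans ⟨⟨D.edgeMap ⟨(_, _), h⟩, D.edgeMap_zero _, D.edgeMap_one _⟩⟩ ih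

/-- Path classes from a base point to the vertices that are compatible with the edges. -/
theorem exists_vertex_classes (hΛ : Λ.Connected)
    (hpot : ∀ (Q : Type u) [Group Q] (c : V → V → Q), (∀ v w, Λ.Adj v w → c w v = (c v w)⁻¹) →
      D.Flat c → ∃ f : V → Q, ∀ v w, Λ.Adj v w → c v w = (f v)⁻¹ * f w) :
    ∃ (x₀ : D.Space) (T : ∀ v, Path.Homotopic.Quotient x₀ (D.vertPt v)),
      ∀ d : Λ.Dart, (T d.fst).trans (D.edgeClass d) = T d.snd := by
  classical
  obtain ⟨v₀⟩ := hΛ.nonempty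
  let x₀ := D.vertPt v₀
  let A : ∀ v, Path.Homotopic.Quotient x₀ (D.vertPt v) := fun v =>
    .mk (D.joined_vertPt hΛ v₀ v).somePath
  let c : V → V → LoopClass D.Space x₀ := fun v w =>
    if h : Λ.Adj v w then .conj (A v) (D.edgeClass ⟨(v, w), h⟩) (A w) else 1
  have hc : ∀ d : Λ.Dart, c d.fst d.snd = .conj (A d.fst) (D.edgeClass d) (A d.snd) :=
    fun d => dif_pos d.adj
  obtain ⟨f, hf⟩ := hpot (LoopClass D.Space x₀) c (by
    intro v w h
    let d : Λ.Dart := ⟨(v, w), h⟩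
    refine (hc d.symm).trans (Eq.trans ?_ (congrArg Inv.inv (hc d)).symm)
    rw [LoopClass.conj_inv, edgeClass_symm]
    rfl) (by
    -- Flatness is witnessed by the loops that go to the center of the disc, out along the spoke
    -- `m`, and back along the chosen path `A`. Passing from one spoke to the next multiplies by the
    -- label of the boundary edge.
    let B : ∀ j, Path.Homotopic.Quotient x₀ (D.discMap j (0, 0)) := fun j =>
      (A (D.vtx j 0)).trans (D.spoke j 0 (D.discMap_one_int j 0).symm).symm
    refine ⟨fun j m => .conj (B j) (D.spoke j m (D.discMap_one_int j m).symm) (A (D.vtx j m)),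
      fun j m => ⟨?_, ?_⟩⟩
    · have h1 := hc (D.dart j m)
      refine Eq.trans ?_ (congrArg (LoopClass.conj (B j) (D.spoke j m
        (D.discMap_one_int j m).symm) (A (D.vtx j m)) * ·) h1).symm
      refine Eq.trans ?_ (LoopClass.conj_mul_conj _ _ _ _ _).symm
      exact congrArg (fun s => LoopClass.conj (B j) s (A (D.vtx j (m + 1))))
        (D.spoke_trans_edgeClass j m).symm
    · have key : ∀ (v w : V) (hv : D.vertPt v = D.discMap j (1, ((m + D.len j : ℤ) : ℝ)))
          (hw : D.vertPt w = D.discMap j (1, m)), v = w →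
          LoopClass.conj (B j) (D.spoke j (m + D.len j) hv) (A v) =
            LoopClass.conj (B j) (D.spoke j m hw) (A w) := by
        rintro v _ hv hw rfl
        rw [D.spoke_add_len j m hv hw]
      exact key _ _ _ _ (D.vtx_add_len j m))
  -- The potential `f` corrects the arbitrary choice of the paths `A`.
  exact ⟨x₀, fun v => Path.Homotopic.Quotient.trans (f v) (A v), fun d =>
    LoopClass.trans_eq_of_conj_eq ((hc d).symm.trans (hf d.fst d.snd d.adj))⟩

/-- The complex is simply connected if its `1`-skeleton is connected and every flat labelling of
the edges is a coboundary. -/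
theorem simplyConnectedSpace_of_potential (hΛ : Λ.Connected)
    (hpot : ∀ (Q : Type u) [Group Q] (c : V → V → Q), (∀ v w, Λ.Adj v w → c w v = (c v w)⁻¹) →
      D.Flat c → ∃ f : V → Q, ∀ v w, Λ.Adj v w → c v w = (f v)⁻¹ * f w) :
    SimplyConnectedSpace D.Space := by
  obtain ⟨x₀, T, hT⟩ := D.exists_vertex_classes hΛ hpot
  -- The class at the center of a disc is defined through corner `0`; `hC` shows that every corner
  -- gives the same one.
  let C : ∀ j, Path.Homotopic.Quotient x₀ (D.discMap j (0, 0)) := fun j =>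
    (T (D.vtx j 0)).trans (D.spoke j 0 (D.discMap_one_int j 0).symm).symm
  have hC : ∀ j m, (C j).trans (D.spoke j m (D.discMap_one_int j m).symm) = T (D.vtx j m) := by
    intro j
    have hs : ∀ m, (C j).trans (D.spoke j (m + 1) (D.discMap_one_int j (m + 1)).symm) =
        ((C j).trans (D.spoke j m (D.discMap_one_int j m).symm)).trans
          (D.edgeClass (D.dart j m)) := fun m =>
      (congrArg (C j).trans (D.spoke_trans_edgeClass j m)).symm.trans (trans_assoc _ _ _).symm
    have hi : ∀ m, (C j).trans (D.spoke j m (D.discMap_one_int j m).symm) = T (D.vtx j m) ↔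
        (C j).trans (D.spoke j (m + 1) (D.discMap_one_int j (m + 1)).symm) =
          T (D.vtx j (m + 1)) := by
      intro m
      constructor
      · intro h
        exact (hs m).trans ((congrArg (fun q => Path.Homotopic.Quotient.trans q
          (D.edgeClass (D.dart j m))) h).trans (hT (D.dart j m)))
      · intro h
        exact trans_right_injective (D.edgeClass (D.dart j m))
          ((hs m).symm.trans (h.trans (hT (D.dart j m)).symm))
    intro m
    induction m using Int.induction_on with
    | zero => rw [trans_assoc, symm_trans, trans_refl]
    | succ m ih => exact (hi m).1 ih
    | pred m ih =>
      rw [hi, sub_add_cancel]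
      exact ih
  have H0 : ∀ i, ∀ x ∈ D.chart i, x = D.chartContr i x 0 := by
    rintro i _ ⟨a, ha, rfl⟩
    rw [D.chartContr_proj ha]
    exact D.proj_eq_contr_zero ha
  have H1 : ∀ i, ∀ x ∈ D.chart i, D.base i = D.chartContr i x 1 := by
    rintro i _ ⟨a, ha, rfl⟩
    rw [D.chartContr_proj ha]
    exact D.base_eq_contr_one ha
  let T' : ∀ i, Path.Homotopic.Quotient x₀ (D.base i) :=
    Sum.rec (motive := fun i => Path.Homotopic.Quotient x₀ (D.base i)) T C
  refine simplyConnectedSpace_of_contractions D.chart D.isOpen_chart D.exists_mem_chart D.base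
    D.chartContr D.continuousOn_chartContr H0 H1 x₀ T' ?_
  intro x
  obtain ⟨a, rfl⟩ := D.isQuotientMap_proj.surjective x
  suffices h : ∃ α : Path.Homotopic.Quotient x₀ (D.proj a), ∀ i (ha : a ∈ D.nbhd i),
      α.trans (pathClass (D.contr i a) 0 1 (D.proj_eq_contr_zero ha) (D.base_eq_contr_one ha)) =
        T' i by
    obtain ⟨α, hα⟩ := h
    refine ⟨α, fun i hx => ?_⟩
    have ha := D.proj_mem_chart.1 hx
    rw [← hα i ha]
    congr 1
    exact pathClass_eq_of_comp_eq (f := D.contr i a) (ContinuousMap.id I)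
      (by rw [D.chartContr_proj ha]; rfl) rfl rfl _ _ _ _
  induction a using Pieces.cases with
  | vert w =>
    refine ⟨T w, ?_⟩
    rintro (v | k) ha
    · obtain rfl : w = v := ha
      exact (congrArg (T w).trans (pathClass_of_const (x := D.vertPt w) (fun _ => rfl) _ _)).trans
        (trans_refl _)
    · exact ha.elim
  | edge d t =>
    refine ⟨(T d.fst).trans (pathClass (D.edgeMap d) 0 t (D.edgeMap_zero d).symm rfl), ?_⟩
    rintro (v | k) ha
    · obtain ⟨hd, -⟩ | ⟨hd, -⟩ := id ha
      · obtain rfl : d.fst = v := hd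
        refine (trans_pathClass_trans (c := 0) (f := D.edgeMap d)
          (k := D.contr (Sum.inl d.fst) (D.edge d t)) (T d.fst) ⟨fun u => t * σ u, by fun_prop⟩
          (D.contrStar_edge_fst rfl t).symm (by simp) (by simp) (D.edgeMap_zero d).symm rfl _
          (D.edgeMap_zero d).symm _).trans ?_
        rw [pathClass_self, trans_refl]
      · obtain rfl : d.snd = v := hd
        exact (trans_pathClass_trans (c := 1) (f := D.edgeMap d)
          (k := D.contr (Sum.inl d.snd) (D.edge d t)) (T d.fst)
          ⟨fun u => σ (σ t * σ u), by fun_prop⟩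
          (D.contrStar_edge_snd rfl t).symm (by simp) (by simp) (D.edgeMap_zero d).symm rfl _
          (D.edgeMap_one d).symm _).trans (hT d)
    · exact ha.elim
  | disc j r x =>
    refine ⟨(C j).trans (pathClass (D.discMap j) (0, 0) (r, x) rfl rfl), ?_⟩
    rintro (v | k) ha
    · obtain ⟨-, m, hm, hx⟩ := id ha
      obtain rfl : D.vtx j m = v := hm
      exact (trans_pathClass_trans (c := (1, (m : ℝ))) (f := D.discMap j)
        (k := D.contr (Sum.inl (D.vtx j m)) (D.disc j (r, x))) (C j)
        ⟨fun u : I => (σ (σ r * σ u), x + u * (m - x)), by fun_prop⟩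
        (D.contrStar_disc rfl hx).symm (by simp) (by simp) rfl rfl _
        (D.discMap_one_int j m).symm _).trans (hC j m)
    · obtain rfl : j = k := ha.1
      refine (trans_pathClass_trans (c := (0, x)) (C j) ⟨fun u : I => (r * σ u, x), by fun_prop⟩
        rfl (by simp) (by simp) rfl rfl _ (D.discMap_zero j _ _) _).trans ?_
      exact (congrArg (C j).trans (D.pathClass_discMap_zero j 0 x rfl _)).trans (trans_refl _)

end AttachingData

/-! ### Covering spaces of flat labellings, and triviality of holonomy. -/

/-- The product of the labels along a walk. -/
def SimpleGraph.Walk.holonomy {V Q : Type*} [Group Q] {Λ : SimpleGraph V} (c : V → V → Q) {v w : V}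
    (p : Λ.Walk v w) : Q :=
  (p.darts.map fun d => c d.fst d.snd).prod

/-- The projected path is closed, hence homotopic to a constant path, and monodromy depends only on
the homotopy class. -/
theorem IsCoveringMap.eq_of_joined {E X : Type*} [TopologicalSpace E] [TopologicalSpace X]
    [SimplyConnectedSpace X] {p : E → X} (hp : IsCoveringMap p) {e e' : E} (h : Joined e e')
    (he : p e = p e') : e = e' := by
  obtain ⟨γ⟩ := h
  have h1 := hp.monodromy_map (.mk γ)
  have h2 : ∀ {y : X} (e' : E) (he' : p e' = y) (δ : Path.Homotopic.Quotient (p e) y)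
      (hy : p e = y), (hp.monodromy δ ⟨e, rfl⟩ : p ⁻¹' {y}) = ⟨e', he'⟩ → e = e' := by
    rintro y e' he' δ rfl h
    rw [Subsingleton.elim δ (.refl _), hp.monodromy_refl] at h
    exact congrArg Subtype.val h
  exact h2 e' rfl _ he h1

namespace AttachingData

variable {V : Type u} {Λ : SimpleGraph V} (D : AttachingData Λ)

section Cover

variable {Q : Type*} [Group Q] (c : V → V → Q) (h : D.Cell → ℤ → Q)

/-- The gluing of the covering space defined by a labelling `c` of the edges, with flatness
witnessed by `h`. -/
inductive CoverGlue : D.Pieces × Q → D.Pieces × Q → Prop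
  | start (d : Λ.Dart) (q : Q) : CoverGlue (D.edge d 0, q) (D.vert d.fst, q)
  | reverse (d : Λ.Dart) (t : I) (q : Q) :
      CoverGlue (D.edge d t, q) (D.edge d.symm (σ t), q * c d.fst d.snd)
  | attach (j : D.Cell) (m : ℤ) (t : I) (q : Q) :
      CoverGlue (D.disc j (1, m + t), q) (D.edge (D.dart j m) t, q * h j m)
  | period (j : D.Cell) (r : I) (x : ℝ) (q : Q) :
      CoverGlue (D.disc j (r, x + D.len j), q) (D.disc j (r, x), q)
  | center (j : D.Cell) (x y : ℝ) (q : Q) : CoverGlue (D.disc j (0, x), q) (D.disc j (0, y), q)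

/-- The covering space defined by a flat labelling. -/
def Cover : Type _ := Quot (D.CoverGlue c h)

variable {D c h}

theorem CoverGlue.glue {a b : D.Pieces × Q} (H : D.CoverGlue c h a b) : D.Glue a.1 b.1 := by
  cases H with
  | start d => exact .start d
  | reverse d t => exact .reverse d t
  | attach j m t => exact .attach j m t
  | period j r x => exact .period j r x
  | center j x y => exact .center j x y

variable (c h) in
theorem Glue.coverGlue {a b : D.Pieces} (H : D.Glue a b) (q : Q) :
    ∃ q', D.CoverGlue c h (a, q) (b, q') := by
  cases H with
  | start d => exact ⟨_, .start d q⟩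
  | reverse d t => exact ⟨_, .reverse d t q⟩
  | attach j m t => exact ⟨_, .attach j m t q⟩
  | period j r x => exact ⟨_, .period j r x q⟩
  | center j x y => exact ⟨_, .center j x y q⟩

theorem CoverGlue.mul_left {a b : D.Pieces × Q} (H : D.CoverGlue c h a b) (g : Q) :
    D.CoverGlue c h (a.1, g * a.2) (b.1, g * b.2) := by
  cases H with
  | start d q => exact .start d _
  | reverse d t q =>
    rw [← mul_assoc]
    exact .reverse d t _
  | attach j m t q =>
    rw [← mul_assoc]
    exact .attach j m t _
  | period j r x q => exact .period j r x _
  | center j x y q => exact .center j x y _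

instance : MulAction Q (D.Cover c h) where
  smul g := Quot.map (fun a => (a.1, g * a.2)) fun _ _ H => H.mul_left g
  one_smul e := by
    obtain ⟨a, q⟩ := e
    exact congrArg (fun q' => Quot.mk _ (a, q')) (one_mul q)
  mul_smul g g' e := by
    obtain ⟨a, q⟩ := e
    exact congrArg (fun q' => Quot.mk _ (a, q')) (mul_assoc g g' q)

variable (D c h)

open Classical in
/-- The sheet over the open star of a vertex that contains a given point, relative to the sheet
that carries its label. -/
noncomputable def sheetStar (v : V) : D.Pieces → Q :=
  Sum.elim (fun _ => 1) <| Sum.elim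
    (fun e => if e.1.fst = v then 1 else c e.1.fst e.1.snd)
    (fun p => h p.1 (D.corner p.1 v p.2.2))

theorem sheetStar_edge_fst {v : V} {d : Λ.Dart} (hd : d.fst = v) (t : I) :
    D.sheetStar c h v (D.edge d t) = 1 := if_pos hd

theorem sheetStar_edge_snd {v : V} {d : Λ.Dart} (hd : d.snd = v) (t : I) :
    D.sheetStar c h v (D.edge d t) = c d.fst d.snd :=
  if_neg fun h' => d.adj.ne (h'.trans hd.symm)

theorem sheetStar_disc {v : V} {j : D.Cell} {m : ℤ} {r : I} {x : ℝ} (hm : D.vtx j m = v)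
    (hx : |x - m| < 1) : D.sheetStar c h v (D.disc j (r, x)) = h j m := by
  change h j (D.corner j v x) = _
  rw [D.corner_eq hm hx]

/-- The sheet over a set of the cover that contains a given point, relative to the sheet that
carries its label. -/
noncomputable def sheet : V ⊕ D.Cell → D.Pieces → Q :=
  Sum.elim (D.sheetStar c h) fun _ _ => 1

variable {D c h}

/-- The product `a.2 * sheet` is a sheet coordinate over the chart. It survives edge reversal by
`hc`, passage from a disc to its boundary by the recursion for `h`, and a full turn by the
periodicity of `h`; the last is where flatness enters. -/
theorem CoverGlue.mul_sheet_eq (hc : ∀ v w, Λ.Adj v w → c w v = (c v w)⁻¹)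
    (hh : ∀ j m, h j (m + 1) = h j m * c (D.vtx j m) (D.vtx j (m + 1)) ∧
      h j (m + D.len j) = h j m)
    {a b : D.Pieces × Q} (H : D.CoverGlue c h a b) {i : V ⊕ D.Cell} (ha : a.1 ∈ D.nbhd i) :
    a.2 * D.sheet c h i a.1 = b.2 * D.sheet c h i b.1 := by
  obtain v | k := i
  · change a.2 * D.sheetStar c h v a.1 = b.2 * D.sheetStar c h v b.1
    cases H with
    | start d q =>
      have hd : d.fst = v := by simpa [edge_mem_star] using show D.edge d 0 ∈ D.star v from ha
      rw [sheetStar_edge_fst D c h hd]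
      rfl
    | reverse d t q =>
      obtain ⟨hd, -⟩ | ⟨hd, -⟩ := ha
      · rw [sheetStar_edge_fst D c h hd, sheetStar_edge_snd D c h (d := d.symm) hd]
        change q * 1 = q * c d.fst d.snd * c d.snd d.fst
        rw [hc _ _ d.adj, mul_one, mul_inv_cancel_right]
      · rw [sheetStar_edge_snd D c h hd, sheetStar_edge_fst D c h (d := d.symm) hd, mul_one]
    | attach j m t q =>
      obtain ⟨-, k, hk, hx⟩ := ha
      rw [sheetStar_disc D c h hk hx]
      obtain ⟨rfl, ht⟩ | ⟨rfl, ht⟩ := attach_mem_star hx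
      · rw [sheetStar_edge_fst D c h (d := D.dart j k) hk, mul_one]
      · rw [sheetStar_edge_snd D c h (d := D.dart j m) hk, (hh j m).1, mul_assoc]
        rfl
    | period j r x q =>
      obtain ⟨-, k, hk, hx⟩ := (Glue.period j r x).mem_star_iff v |>.1 ha
      rw [sheetStar_disc D c h hk hx, sheetStar_disc D c h (m := k + D.len j)
        (by rw [D.vtx_add_len, hk]) (by push_cast; rwa [add_sub_add_right_eq_sub]), (hh j k).2]
    | center j x y q => exact absurd ha.1 (lt_irrefl _)
  · cases H with
    | start d q => exact ha.elim
    | reverse d t q => exact ha.elim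
    | attach j m t q => exact absurd ha.2 (lt_irrefl _)
    | period j r x q => rfl
    | center j x y q => rfl

variable (D c h)

/-- The covering map. -/
def coverProj : D.Cover c h → D.Space :=
  Quot.lift (fun a => D.proj a.1) fun _ _ H => Quot.sound H.glue

/-- The projection from the cells of the covering space. -/
def coverMk (a : D.Pieces × Q) : D.Cover c h := Quot.mk _ a

variable {c h}

section SheetSet

variable (hc : ∀ v w, Λ.Adj v w → c w v = (c v w)⁻¹)
    (hh : ∀ j m, h j (m + 1) = h j m * c (D.vtx j m) (D.vtx j (m + 1)) ∧
      h j (m + D.len j) = h j m)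

/-- A sheet of the covering space over a set of the cover. -/
def sheetSet (i : V ⊕ D.Cell) (q : Q) : Set (D.Cover c h) :=
  Set.ofPred <| Quot.lift (fun a => a.1 ∈ D.nbhd i ∧ a.2 * D.sheet c h i a.1 = q) fun a b H => by
    rw [eq_iff_iff, H.glue.mem_nbhd_iff i]
    refine and_congr_right fun hb => ?_
    rw [H.mul_sheet_eq hc hh ((H.glue.mem_nbhd_iff i).2 hb)]

end SheetSet

variable (c h) [TopologicalSpace Q]

instance : TopologicalSpace (D.Cover c h) :=
  inferInstanceAs (TopologicalSpace (Quot (D.CoverGlue c h)))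

theorem isQuotientMap_coverMk : IsQuotientMap (D.coverMk c h) := isQuotientMap_quot_mk

theorem isQuotientMap_coverProj : IsQuotientMap (D.coverProj c h) := by
  have h1 : D.coverProj c h ∘ D.coverMk c h = D.proj ∘ Prod.fst := rfl
  have h2 : IsQuotientMap (D.proj ∘ (Prod.fst : D.Pieces × Q → D.Pieces)) :=
    D.isQuotientMap_proj.comp
      (isOpenMap_fst.isQuotientMap continuous_fst Prod.fst_surjective)
  refine IsQuotientMap.of_comp (D.isQuotientMap_coverMk c h).continuous ?_ (h1 ▸ h2)
  exact (D.isQuotientMap_coverMk c h).continuous_iff.2 (h1 ▸ h2.continuous)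

theorem continuousOn_sheet (i : V ⊕ D.Cell) : ContinuousOn (D.sheet c h i) (D.nbhd i) := by
  refine D.continuousOn_nbhd (fun d t ht => ?_) (fun j z hz => ?_)
  · obtain v | j := i
    · exact continuousAt_const
    · exact continuousAt_const
  · obtain v | k := i
    · obtain ⟨-, m, hm, hx⟩ := hz
      refine (continuousAt_const (y := h j m)).congr ?_
      filter_upwards [continuous_snd.continuousAt.eventually (D.corner_eventually hm hx)] with w hw
      change _ = h j (D.corner j v w.2)
      rw [hw]
    · exact continuousAt_const

variable {c h}

theorem joined_coverMk_dart (d : Λ.Dart) (q : Q) :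
    Joined (D.coverMk c h (D.vert d.fst, q)) (D.coverMk c h (D.vert d.snd, q * c d.fst d.snd)) := by
  refine ⟨⟨⟨fun t => D.coverMk c h (D.edge d t, q), ?_⟩, ?_, ?_⟩⟩
  · exact (D.isQuotientMap_coverMk c h).continuous.comp
      ((D.continuous_edge d).prodMk continuous_const)
  · exact Quot.sound (.start d q)
  · refine (Quot.sound (.reverse d 1 q)).trans ?_
    rw [unitInterval.symm_one]
    exact Quot.sound (.start d.symm _)

theorem joined_coverMk_walk {v w : V} (p : Λ.Walk v w) (q : Q) :
    Joined (D.coverMk c h (D.vert v, q)) (D.coverMk c h (D.vert w, q * p.holonomy c)) := by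
  induction p generalizing q with
  | nil =>
    rw [SimpleGraph.Walk.holonomy, SimpleGraph.Walk.darts_nil, List.map_nil, List.prod_nil, mul_one]
  | cons hvw p ih =>
    rw [SimpleGraph.Walk.holonomy, SimpleGraph.Walk.darts_cons, List.map_cons, List.prod_cons,
      ← mul_assoc]
    exact (D.joined_coverMk_dart ⟨(_, _), hvw⟩ q).trans (ih _)

variable [DiscreteTopology Q]

instance : ContinuousConstSMul Q (D.Cover c h) where
  continuous_const_smul g := by
    rw [(D.isQuotientMap_coverMk c h).continuous_iff]
    have : Continuous fun a : D.Pieces × Q => (a.1, g * a.2) :=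
      continuous_fst.prodMk ((continuous_of_discreteTopology (f := (g * ·))).comp continuous_snd)
    exact (D.isQuotientMap_coverMk c h).continuous.comp this

theorem isOpen_sheetSet (hc : ∀ v w, Λ.Adj v w → c w v = (c v w)⁻¹)
    (hh : ∀ j m, h j (m + 1) = h j m * c (D.vtx j m) (D.vtx j (m + 1)) ∧
      h j (m + D.len j) = h j m)
    (i : V ⊕ D.Cell) (q : Q) : IsOpen (D.sheetSet hc hh i q) := by
  rw [← (D.isQuotientMap_coverMk c h).isOpen_preimage]
  have hcont : ContinuousOn (fun a : D.Pieces × Q => a.2 * D.sheet c h i a.1)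
      (Prod.fst ⁻¹' D.nbhd i) :=
    (continuous_of_discreteTopology (f := fun p : Q × Q => p.1 * p.2)).comp_continuousOn
      (continuous_snd.continuousOn.prodMk
        ((D.continuousOn_sheet c h i).comp continuous_fst.continuousOn fun a ha => ha))
  exact hcont.isOpen_inter_preimage ((D.isOpen_nbhd i).preimage continuous_fst)
    (isOpen_discrete {q})

/-- Fibres are orbits because each gluing lifts to every sheet. A sheet is disjoint from its
translate by `g ≠ 1` because `g` multiplies the sheet coordinate on the left. -/
theorem isQuotientCoveringMap_coverProj
    (hc : ∀ v w, Λ.Adj v w → c w v = (c v w)⁻¹)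
    (hh : ∀ j m, h j (m + 1) = h j m * c (D.vtx j m) (D.vtx j (m + 1)) ∧
      h j (m + D.len j) = h j m) :
    IsQuotientCoveringMap (D.coverProj c h) Q where
  toIsQuotientMap := D.isQuotientMap_coverProj c h
  toContinuousConstSMul := inferInstance
  apply_eq_iff_mem_orbit {e₁ e₂} := by
    obtain ⟨⟨a, q⟩, rfl⟩ := (D.isQuotientMap_coverMk c h).surjective e₁
    obtain ⟨⟨b, q'⟩, rfl⟩ := (D.isQuotientMap_coverMk c h).surjective e₂
    constructor
    · intro hab
      have key : ∀ a b : D.Pieces, Relation.EqvGen D.Glue a b → ∀ q q',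
          D.coverMk c h (a, q) ∈ MulAction.orbit Q (D.coverMk c h (b, q')) := by
        have hfib : ∀ (a : D.Pieces) (q q' : Q),
            D.coverMk c h (a, q) ∈ MulAction.orbit Q (D.coverMk c h (a, q')) := fun a q q' =>
          ⟨q * q'⁻¹, congrArg (fun x => D.coverMk c h (a, x)) (inv_mul_cancel_right q q')⟩
        intro a b H
        induction H with
        | rel a b H =>
          intro q q'
          obtain ⟨q'', H'⟩ := H.coverGlue c h q
          have : D.coverMk c h (a, q) = D.coverMk c h (b, q'') := Quot.sound H'
          rw [this]
          exact hfib b q'' q'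
        | refl a => exact hfib a
        | symm a b _ ih => exact fun q q' => MulAction.mem_orbit_symm.1 (ih q' q)
        | trans a b d _ _ ih1 ih2 =>
          intro q q'
          rw [← MulAction.orbit_eq_iff.2 (ih2 1 q')]
          exact ih1 q 1
      exact key a b (Quot.eqvGen_exact hab) q q'
    · rintro ⟨g, hg⟩
      rw [← hg]
      rfl
  disjoint e := by
    obtain ⟨⟨a, q⟩, rfl⟩ := (D.isQuotientMap_coverMk c h).surjective e
    obtain ⟨i, hi⟩ := D.exists_mem_nbhd a
    refine ⟨D.sheetSet hc hh i (q * D.sheet c h i a), (D.isOpen_sheetSet hc hh i _).mem_nhds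
      ⟨hi, rfl⟩, ?_⟩
    rintro g ⟨_, ⟨e, he, rfl⟩, he'⟩
    obtain ⟨⟨b, r⟩, rfl⟩ := (D.isQuotientMap_coverMk c h).surjective e
    have h1 : r * D.sheet c h i b = q * D.sheet c h i a := he.2
    have h2 : g * r * D.sheet c h i b = q * D.sheet c h i a := he'.2
    rw [← h1, mul_assoc] at h2
    exact mul_eq_right.1 h2

end Cover

/-- If the complex is simply connected, the labels of a flat labelling have trivial product around
every closed walk. -/
theorem holonomy_eq_one {Q : Type*} [Group Q] {c : V → V → Q}
    (hc : ∀ v w, Λ.Adj v w → c w v = (c v w)⁻¹) [SimplyConnectedSpace D.Space]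
    (hflat : D.Flat c) {v : V} (p : Λ.Walk v v) : p.holonomy c = 1 := by
  let : TopologicalSpace Q := ⊥
  have : DiscreteTopology Q := ⟨rfl⟩
  obtain ⟨h, hh⟩ := hflat
  have hcov := (D.isQuotientCoveringMap_coverProj hc hh).isCoveringMap
  -- The lift of `p` from the sheet `1` ends over `v` in the sheet of its holonomy; the sheet
  -- coordinate over the star of `v` tells the two points apart unless the holonomy is trivial.
  have := hcov.eq_of_joined (D.joined_coverMk_walk (c := c) (h := h) p 1) rfl
  have h1 : D.coverMk c h (D.vert v, 1) ∈ D.sheetSet hc hh (Sum.inl v) 1 :=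
    ⟨D.vert_mem_star.2 rfl, mul_one _⟩
  rw [this] at h1
  have h2 : 1 * p.holonomy c * 1 = 1 := h1.2
  simpa using h2

end AttachingData

/-! ### Polar coordinates as a quotient map onto the disc. -/

section Polar

/-- Polar coordinates on the closed unit disc, the full turn being `n` units of angle. -/
noncomputable def polar (n : ℕ) : C(I × ℝ, Metric.closedBall (0 : ℂ) 1) where
  toFun z := ⟨(z.1 : ℝ) * Complex.exp ((2 * Real.pi * z.2 / n : ℝ) * Complex.I), by
    rw [mem_closedBall_zero_iff, norm_mul, Complex.norm_exp_ofReal_mul_I, mul_one,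
      Complex.norm_real, Real.norm_of_nonneg z.1.2.1]
    exact z.1.2.2⟩
  continuous_toFun := by fun_prop

theorem polar_coe (n : ℕ) (r : I) (x : ℝ) :
    (polar n (r, x) : ℂ) = (r : ℝ) * Complex.exp ((2 * Real.pi * x / n : ℝ) * Complex.I) := rfl

theorem polar_zero (n : ℕ) (x y : ℝ) : polar n (0, x) = polar n (0, y) := by
  ext
  simp [polar_coe]

theorem polar_add {n : ℕ} (hn : 0 < n) (r : I) (x : ℝ) : polar n (r, x + n) = polar n (r, x) := by
  have hn' : (n : ℝ) ≠ 0 := by positivity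
  ext
  rw [polar_coe, polar_coe]
  congr 1
  rw [Complex.exp_eq_exp_iff_exists_int]
  refine ⟨1, ?_⟩
  have : 2 * Real.pi * (x + n) / n = 2 * Real.pi * x / n + 2 * Real.pi := by
    field_simp
  rw [this]
  push_cast
  ring

theorem polar_eq_iff {n : ℕ} (hn : 0 < n) {z w : I × ℝ} (h : polar n z = polar n w) :
    z.1 = w.1 ∧ (z.1 = 0 ∨ ∃ k : ℤ, z.2 = w.2 + k * n) := by
  have hn' : (n : ℝ) ≠ 0 := by positivity
  obtain ⟨r, x⟩ := z
  obtain ⟨s, y⟩ := w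
  have h1 := congrArg Subtype.val h
  rw [polar_coe, polar_coe] at h1
  have h2 := congrArg norm h1
  simp only [norm_mul, Complex.norm_exp_ofReal_mul_I, mul_one, Complex.norm_real,
    Real.norm_of_nonneg r.2.1, Real.norm_of_nonneg s.2.1] at h2
  obtain rfl : r = s := Subtype.ext h2
  refine ⟨rfl, or_iff_not_imp_left.2 fun hr => ?_⟩
  have hr' : ((r : ℝ) : ℂ) ≠ 0 := by
    rw [Complex.ofReal_ne_zero]
    exact fun h => hr (Subtype.ext h)
  obtain ⟨k, hk⟩ := Complex.exp_eq_exp_iff_exists_int.1 (mul_left_cancel₀ hr' h1)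
  refine ⟨k, ?_⟩
  have h3 : ((2 * Real.pi * x / n : ℝ) : ℂ) =
      ((2 * Real.pi * y / n + k * (2 * Real.pi) : ℝ) : ℂ) := by
    apply mul_right_cancel₀ Complex.I_ne_zero
    rw [hk]
    push_cast
    ring
  have h4 := Complex.ofReal_injective h3
  have := Real.pi_pos
  field_simp at h4
  linarith

/-- Already on a compact range of angles the map is surjective, hence a closed quotient map onto a
Hausdorff space; the quotient property then passes to all angles. -/
theorem isQuotientMap_polar {n : ℕ} (hn : 0 < n) : IsQuotientMap (polar n) := by
  have hn' : (0 : ℝ) < n := by positivity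
  let i : I × Set.Icc (-n : ℝ) n → I × ℝ := fun z => (z.1, z.2)
  have hi : Continuous i := by fun_prop
  have hs : Function.Surjective (polar n ∘ i) := by
    intro z
    have h1 := Complex.arg_le_pi (z : ℂ)
    have h2 := (Complex.neg_pi_lt_arg (z : ℂ)).le
    have := Real.pi_pos
    refine ⟨(⟨‖(z : ℂ)‖, norm_nonneg _, mem_closedBall_zero_iff.1 z.2⟩,
      ⟨n * Complex.arg z / (2 * Real.pi), ?_, ?_⟩), ?_⟩
    · rw [le_div_iff₀ (by positivity)]
      nlinarith
    · rw [div_le_iff₀ (by positivity)]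
      nlinarith
    · ext
      change ((‖(z : ℂ)‖ : ℝ) : ℂ) * Complex.exp
        ((2 * Real.pi * (n * Complex.arg z / (2 * Real.pi)) / n : ℝ) * Complex.I) = z
      have : 2 * Real.pi * (n * Complex.arg z / (2 * Real.pi)) / n = Complex.arg z := by
        field_simp
      rw [this, Complex.norm_mul_exp_arg_mul_I]
  have hc : Continuous (polar n ∘ i) := (polar n).continuous.comp hi
  exact IsQuotientMap.of_comp hi (polar n).continuous (hc.isClosedMap.isQuotientMap hc hs)

end Polar

/-! ### Comparison of the polar model with the `2`-complex. -/

namespace GroupPair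

section Comparison

variable {V : Type u} {Λ : SimpleGraph V} {L : Set (ClosedWalk Λ)}

/-- The attaching data of a set of closed walks of positive length. -/
def attachingData (hL : ∀ p ∈ L, 0 < p.2.length) : AttachingData Λ where
  Cell := L
  len p := p.1.2.length
  vtx p m := p.1.2.getVert (m % p.1.2.length).toNat
  vtx_add_len p m := by rw [Int.add_emod_right]
  adj p m := by
    have hn := hL p.1 p.2
    have h0 := Int.emod_nonneg m (b := p.1.2.length) (by omega)
    have h1 := Int.emod_lt_of_pos m (b := p.1.2.length) (by omega)
    have h2 := p.1.2.adj_getVert_succ (i := (m % p.1.2.length).toNat) (by omega)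
    convert h2 using 1
    rw [Int.add_emod]
    -- At the last edge the index wraps around to `0`, which is the same vertex because the walk is
    -- closed.
    by_cases h : m % p.1.2.length + 1 = p.1.2.length
    · have h3 : (m % p.1.2.length).toNat + 1 = p.1.2.length := by omega
      rw [h3, SimpleGraph.Walk.getVert_length, ← Int.add_emod, ← Int.emod_add_emod, h,
        Int.emod_self]
      simp
    · rw [← Int.add_emod, ← Int.emod_add_emod, Int.emod_eq_of_lt (by omega) (by omega)]
      congr 1
      omega

variable (hL : ∀ p ∈ L, 0 < p.2.length)

theorem attachingData_vtx_natCast {p : L} {k : ℕ} (hk : k ≤ p.1.2.length) :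
    (attachingData hL).vtx p k = p.1.2.getVert k := by
  change p.1.2.getVert ((k : ℤ) % p.1.2.length).toNat = _
  obtain h | h := hk.lt_or_eq
  · rw [Int.emod_eq_of_lt (by omega) (by omega), Int.toNat_natCast]
  · rw [← h, Int.emod_self, h, SimpleGraph.Walk.getVert_length]
    simp

theorem attachingData_dart_natCast {p : L} (k : Fin p.1.2.darts.length) :
    (attachingData hL).dart p (k : ℕ) = p.1.2.darts.get k := by
  have hk : (k : ℕ) < p.1.2.length := k.2.trans_eq p.1.2.length_darts
  rw [List.get_eq_getElem, SimpleGraph.Walk.darts_getElem_eq_getVert]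
  ext
  · exact attachingData_vtx_natCast hL hk.le
  · exact attachingData_vtx_natCast hL (k := k + 1) hk

theorem attachingData_dart_emod (p : L) (m : ℤ) :
    (attachingData hL).dart p (m % p.1.2.length) = (attachingData hL).dart p m := by
  ext
  · change p.1.2.getVert _ = p.1.2.getVert _
    rw [Int.emod_emod]
  · change p.1.2.getVert _ = p.1.2.getVert _
    rw [Int.emod_add_emod]

theorem exists_dart_eq_get (p : L) (m : ℤ) : ∃ k : Fin p.1.2.darts.length,
    ((k : ℕ) : ℤ) = m % p.1.2.length ∧ (attachingData hL).dart p m = p.1.2.darts.get k := by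
  have hn := hL p.1 p.2
  have h0 := Int.emod_nonneg m (b := p.1.2.length) (by omega)
  have h1 := Int.emod_lt_of_pos m (b := p.1.2.length) (by omega)
  refine ⟨⟨(m % p.1.2.length).toNat, ?_⟩, Int.toNat_of_nonneg h0, ?_⟩
  · rw [SimpleGraph.Walk.length_darts]
    omega
  · rw [← attachingData_dart_natCast hL, Int.toNat_of_nonneg h0, attachingData_dart_emod]

theorem discMap_add_mul_len (D : AttachingData Λ) (j : D.Cell) (r : I) (x : ℝ) (k : ℤ) :
    D.discMap j (r, x + k * D.len j) = D.discMap j (r, x) := by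
  induction k using Int.induction_on with
  | zero => simp
  | succ k ih =>
    rw [← ih, ← D.discMap_add_len j r (x + ((k : ℕ) : ℤ) * _)]
    congr 2
    push_cast
    ring
  | pred k ih =>
    rw [← ih, ← D.discMap_add_len j r (x + ((-k - 1 : ℤ) : ℝ) * _)]
    congr 2
    push_cast
    ring

/-- The map from the model with polar coordinates to the `2`-complex. -/
noncomputable def toTwoComplex : (attachingData hL).Space → TwoComplex Λ L :=
  Quot.lift (Sum.elim (fun v => Quot.mk _ (Cells.vert v.1)) <| Sum.elim
    (fun e => Quot.mk _ (Cells.edge e.1 e.2))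
    (fun p => Quot.mk _ (Cells.disc p.1 (polar p.1.1.2.length p.2)))) fun a b h => by
      cases h with
      | start d => exact Quot.sound (Glue.start d)
      | reverse d t => exact Quot.sound (Glue.reverse d t)
      | attach p m t =>
        have hn := hL p.1 p.2
        have hn' : (p.1.2.length : ℝ) ≠ 0 := by positivity
        obtain ⟨k, hk, hd⟩ := exists_dart_eq_get hL p m
        refine Eq.trans ?_ (congrArg (fun d => Quot.mk _ (Cells.edge d t)) hd).symm
        refine Quot.sound (Glue.attach p k t _ ?_)
        have hm : (m : ℝ) = (k : ℕ) + (m / p.1.2.length : ℤ) * (p.1.2.length : ℝ) := by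
          have := Int.emod_add_mul_ediv m p.1.2.length
          rw [← hk] at this
          rw [mul_comm]
          exact_mod_cast this.symm
        rw [polar_coe, Set.Icc.coe_one, Complex.ofReal_one, one_mul,
          Complex.exp_eq_exp_iff_exists_int]
        refine ⟨m / p.1.2.length, ?_⟩
        have : 2 * Real.pi * (m + t) / p.1.2.length =
            2 * Real.pi * (((k : ℕ) + t) / p.1.2.length) +
              (m / p.1.2.length : ℤ) * (2 * Real.pi) := by
          rw [hm]
          field_simp
          ring
        rw [this]
        push_cast
        ring
      | period p r x =>
        exact congrArg (fun z => Quot.mk _ (Cells.disc p z)) (polar_add (hL p.1 p.2) r x)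
      | center p x y => exact congrArg (fun z => Quot.mk _ (Cells.disc p z)) (polar_zero _ x y)

theorem continuous_toTwoComplex : Continuous (toTwoComplex hL) := by
  rw [(attachingData hL).isQuotientMap_proj.continuous_iff]
  have hq : Continuous (Quot.mk (Glue Λ L)) := continuous_quot_mk
  refine continuous_sum_dom.2 ⟨continuous_sigma fun v => continuous_of_discreteTopology,
    continuous_sum_dom.2 ⟨continuous_sigma fun d => ?_, continuous_sigma fun p => ?_⟩⟩
  · exact hq.comp (continuous_inr.comp (continuous_inl.comp
      (@continuous_sigmaMk _ (fun _ : Λ.Dart => I) _ d)))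
  · exact hq.comp (continuous_inr.comp (continuous_inr.comp
      (continuous_sigmaMk.comp (polar p.1.2.length).continuous)))

/-- The characteristic map of a disc of the `2`-complex, with values in the model. -/
noncomputable def ballMap (p : L) :
    C(Metric.closedBall (0 : ℂ) 1, (attachingData hL).Space) :=
  IsQuotientMap.lift (f := polar p.1.2.length) (isQuotientMap_polar (hL p.1 p.2))
    ((attachingData hL).discMap p) fun z w h => by
      obtain ⟨r, x⟩ := z
      obtain ⟨s, y⟩ := w
      obtain ⟨h1, h2⟩ := polar_eq_iff (hL p.1 p.2) h
      obtain rfl : r = s := h1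
      obtain h2 | ⟨k, hk⟩ := h2
      · obtain rfl : r = 0 := h2
        exact (attachingData hL).discMap_zero p x y
      · obtain rfl : x = y + k * p.1.2.length := hk
        exact discMap_add_mul_len (attachingData hL) p r y k

theorem ballMap_polar (p : L) (z : I × ℝ) :
    ballMap hL p (polar p.1.2.length z) = (attachingData hL).discMap p z := by
  have h : (ballMap hL p).comp (polar p.1.2.length) = (attachingData hL).discMap p :=
    IsQuotientMap.lift_comp _ _ _
  exact DFunLike.congr_fun h z

/-- The map from the `2`-complex to the model with polar coordinates. -/
noncomputable def ofTwoComplex : TwoComplex Λ L → (attachingData hL).Space :=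
  Quot.lift (Sum.elim (fun v => (attachingData hL).vertPt v.1) <| Sum.elim
    (fun e => (attachingData hL).edgeMap e.1 e.2) (fun p => ballMap hL p.1 p.2)) fun a b h => by
      cases h with
      | start d => exact (attachingData hL).edgeMap_zero d
      | reverse d t => exact ((attachingData hL).edgeMap_symm d t).symm
      | attach p k t z hz =>
        have hn := hL p.1 p.2
        have : z = polar p.1.2.length (1, ((k : ℕ) : ℤ) + t) := by
          ext
          rw [hz, polar_coe]
          push_cast
          rw [one_mul]
          congr 1
          ring
        change ballMap hL p z = (attachingData hL).edgeMap _ t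
        rw [this, ballMap_polar, (attachingData hL).discMap_one p (k : ℕ) t,
          attachingData_dart_natCast]

theorem continuous_ofTwoComplex : Continuous (ofTwoComplex hL) := by
  have hq : IsQuotientMap (Quot.mk (Glue Λ L)) := isQuotientMap_quot_mk
  refine hq.continuous_iff.2 ?_
  refine continuous_sum_dom.2 ⟨continuous_sigma fun v => continuous_of_discreteTopology,
    continuous_sum_dom.2 ⟨continuous_sigma fun d => ?_, continuous_sigma fun p => ?_⟩⟩
  · exact ((attachingData hL).edgeMap d).continuous
  · exact (ballMap hL p).continuous

/-- The model with polar coordinates is homeomorphic to the `2`-complex. -/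
noncomputable def homeomorphTwoComplex : (attachingData hL).Space ≃ₜ TwoComplex Λ L where
  toFun := toTwoComplex hL
  invFun := ofTwoComplex hL
  left_inv x := by
    obtain ⟨a, rfl⟩ := (attachingData hL).isQuotientMap_proj.surjective x
    induction a using AttachingData.Pieces.cases with
    | vert v => rfl
    | edge d t => rfl
    | disc p r x => exact ballMap_polar hL p (r, x)
  right_inv x := by
    obtain ⟨a⟩ := x
    obtain ⟨v, _⟩ | ⟨d, t⟩ | ⟨p, z⟩ := a
    · rfl
    · rfl
    · obtain ⟨w, rfl⟩ := (isQuotientMap_polar (hL p.1 p.2)).surjective z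
      change toTwoComplex hL (ballMap hL p (polar p.1.2.length w)) = _
      rw [ballMap_polar]
      rfl
  continuous_toFun := continuous_toTwoComplex hL
  continuous_invFun := continuous_ofTwoComplex hL

/-- A labelling with trivial product around each loop is flat. -/
theorem attachingData_flat {Q : Type*} [Group Q] {c : V → V → Q}
    (hc : ∀ p ∈ L, p.2.holonomy c = 1) : (attachingData hL).Flat c := by
  let h : L → ℕ → Q := fun p k => ((p.1.2.darts.take k).map fun d => c d.fst d.snd).prod
  have hsucc : ∀ (p : L) (k : ℕ), k < p.1.2.length →
      h p (k + 1) = h p k * c (p.1.2.getVert k) (p.1.2.getVert (k + 1)) := by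
    intro p k hk
    have hk' : k < p.1.2.darts.length := by rwa [SimpleGraph.Walk.length_darts]
    simp only [h]
    rw [List.take_add_one, List.getElem?_eq_getElem hk', SimpleGraph.Walk.darts_getElem_eq_getVert]
    simp
  have hlen : ∀ p : L, h p p.1.2.length = 1 := by
    intro p
    rw [← hc p.1 p.2, SimpleGraph.Walk.holonomy, ← SimpleGraph.Walk.length_darts]
    simp only [h]
    rw [List.take_length]
  have hzero : ∀ p : L, h p 0 = 1 := fun p => rfl
  refine ⟨fun (p : L) m => h p (m % p.1.2.length).toNat, fun (p : L) m => ⟨?_, ?_⟩⟩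
  · have hn := hL p.1 p.2
    have h0 := Int.emod_nonneg m (b := p.1.2.length) (by omega)
    have h1 := Int.emod_lt_of_pos m (b := p.1.2.length) (by omega)
    obtain ⟨k, hk⟩ := Int.eq_ofNat_of_zero_le h0
    have hv : (attachingData hL).vtx p m = p.1.2.getVert k := by
      change p.1.2.getVert (m % p.1.2.length).toNat = _
      rw [hk, Int.toNat_natCast]
    have hv' : (attachingData hL).vtx p (m + 1) = p.1.2.getVert (k + 1) := by
      have := congrArg (fun d => d.snd) (attachingData_dart_emod hL p m)
      rw [hk] at this
      change (attachingData hL).vtx p (k + 1) = (attachingData hL).vtx p (m + 1) at this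
      rw [← this]
      exact attachingData_vtx_natCast hL (k := k + 1) (by omega)
    change h p ((m + 1) % p.1.2.length).toNat = h p (m % p.1.2.length).toNat *
      c ((attachingData hL).vtx p m) ((attachingData hL).vtx p (m + 1))
    rw [hv, hv', hk, Int.toNat_natCast, ← hsucc p k (by omega), ← Int.emod_add_emod, hk]
    by_cases hlast : k + 1 = p.1.2.length
    · have : ((k : ℤ) + 1) = (p.1.2.length : ℤ) := by omega
      rw [this, Int.emod_self, hlast, hlen]
      exact hzero p
    · rw [Int.emod_eq_of_lt (by omega) (by omega)]
      congr 1
  · change h p ((m + p.1.2.length) % p.1.2.length).toNat = _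
    rw [Int.add_emod_right]

/-- The witness of flatness at `k` is its value at `0` times the product of the first `k` labels;
after one period it returns to its value at `0`. -/
theorem holonomy_eq_one_of_flat {Q : Type*} [Group Q] {c : V → V → Q}
    (hc : (attachingData hL).Flat c) {p : ClosedWalk Λ} (hp : p ∈ L) : p.2.holonomy c = 1 := by
  obtain ⟨h, hh⟩ := hc
  let j : L := ⟨p, hp⟩
  have key : ∀ k : ℕ, k ≤ p.2.length →
      h j 0 * ((p.2.darts.take k).map fun d => c d.fst d.snd).prod = h j k := by
    intro k
    induction k with
    | zero => simp
    | succ k ih =>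
      intro hk
      have hk' : k < p.2.darts.length := by rwa [SimpleGraph.Walk.length_darts]
      rw [List.take_add_one, List.getElem?_eq_getElem hk',
        SimpleGraph.Walk.darts_getElem_eq_getVert]
      have h1 := (hh j k).1
      rw [attachingData_vtx_natCast hL (p := j) (k := k) (show k ≤ p.2.length by omega)] at h1
      have h2 := attachingData_vtx_natCast hL (p := j) (k := k + 1) hk
      push_cast at h2 ⊢
      rw [h2] at h1
      rw [h1, ← ih (by omega)]
      simp [j, mul_assoc]
  have h1 := key _ le_rfl
  have h2 := (hh j 0).2
  rw [zero_add] at h2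
  rw [← SimpleGraph.Walk.length_darts, List.take_length, SimpleGraph.Walk.length_darts] at h1
  exact mul_eq_left.1 (h1.trans h2)

end Comparison

end GroupPair

/-! ### Calculus of holonomy. -/

namespace SimpleGraph.Walk

variable {V Q : Type*} [Group Q] {Λ : SimpleGraph V} {c : V → V → Q}

@[simp] theorem holonomy_nil {v : V} : (nil : Λ.Walk v v).holonomy c = 1 := rfl

@[simp] theorem holonomy_cons {v w x : V} (h : Λ.Adj v w) (p : Λ.Walk w x) :
    (cons h p).holonomy c = c v w * p.holonomy c := by
  rw [holonomy, darts_cons, List.map_cons, List.prod_cons, holonomy]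

@[simp] theorem holonomy_append {v w x : V} (p : Λ.Walk v w) (q : Λ.Walk w x) :
    (p.append q).holonomy c = p.holonomy c * q.holonomy c := by
  rw [holonomy, darts_append, List.map_append, List.prod_append, holonomy, holonomy]

@[simp] theorem holonomy_concat {v w x : V} (p : Λ.Walk v w) (h : Λ.Adj w x) :
    (p.concat h).holonomy c = p.holonomy c * c w x := by
  rw [concat_eq_append, holonomy_append, holonomy_cons, holonomy_nil, mul_one]

theorem holonomy_reverse (hc : ∀ v w, Λ.Adj v w → c w v = (c v w)⁻¹) {v w : V} (p : Λ.Walk v w) :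
    p.reverse.holonomy c = (p.holonomy c)⁻¹ := by
  induction p with
  | nil => simp
  | cons h p ih =>
    rw [reverse_cons, holonomy_append, ih, holonomy_cons, holonomy_nil, mul_one, holonomy_cons,
      mul_inv_rev, hc _ _ h]

end SimpleGraph.Walk

/-! ### The combinatorial criterion, and cone-avoiding walks in the coned-off Cayley graph. -/

namespace GroupPair

/-- The `2`-complex is simply connected if and only if each labelling of the edges by a group that
has trivial product along the attaching loops has trivial product along all closed walks. -/
theorem simplyConnectedSpace_twoComplex_iff {V : Type u} {Λ : SimpleGraph V}
    {L : Set (ClosedWalk Λ)} (hL : ∀ p ∈ L, 0 < p.2.length) (hΛ : Λ.Connected) :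
    SimplyConnectedSpace (TwoComplex Λ L) ↔
      ∀ (Q : Type u) [Group Q] (c : V → V → Q), (∀ v w, Λ.Adj v w → c w v = (c v w)⁻¹) →
        (∀ p ∈ L, p.2.holonomy c = 1) → ∀ v (p : Λ.Walk v v), p.holonomy c = 1 := by
  rw [← (homeomorphTwoComplex hL).toHomotopyEquiv.simplyConnectedSpace_iff]
  constructor
  · intro _ Q _ c hc hp v p
    exact (attachingData hL).holonomy_eq_one hc (attachingData_flat hL hp) p
  · intro H
    refine (attachingData hL).simplyConnectedSpace_of_potential hΛ fun Q _ c hc hflat => ?_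
    have H' := H Q c hc fun p hp => holonomy_eq_one_of_flat hL hflat hp
    obtain ⟨v₀⟩ := hΛ.nonempty
    -- The potential at `v` is the holonomy along a chosen walk from `v₀`; two chosen walks and an
    -- edge form a closed walk.
    let p : ∀ v, Λ.Walk v₀ v := fun v => (hΛ.preconnected v₀ v).some
    refine ⟨fun v => (p v).holonomy c, fun v w h => ?_⟩
    have := H' _ (((p v).concat h).append (p w).reverse)
    rw [SimpleGraph.Walk.holonomy_append, SimpleGraph.Walk.holonomy_concat,
      SimpleGraph.Walk.holonomy_reverse hc, mul_inv_eq_one] at this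
    change c v w = ((p v).holonomy c)⁻¹ * (p w).holonomy c
    rw [← this, inv_mul_cancel_left]

section ConedOff

variable {G : Type u} {ι : Type v} [Group G] {P : ι → Subgroup G} {S : Set G}

theorem adj_inl_inl {g g' : G} : (conedOffCayleyGraph P S).Adj (Sum.inl g) (Sum.inl g') ↔
    g ≠ g' ∧ (g⁻¹ * g' ∈ S ∨ g'⁻¹ * g ∈ S) := by
  rw [conedOffCayleyGraph, SimpleGraph.fromRel_adj]
  refine and_congr (by simp) (or_congr ⟨?_, fun h => .cayley _ _ h⟩ ⟨?_, fun h => .cayley _ _ h⟩)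
  · rintro (⟨_, _, h⟩ | _)
    exact h
  · rintro (⟨_, _, h⟩ | _)
    exact h

theorem adj_inl_inr {g : G} {A : Σ i, G ⧸ P i} :
    (conedOffCayleyGraph P S).Adj (Sum.inl g) (Sum.inr A) ↔ (g : G ⧸ P A.1) = A.2 := by
  rw [conedOffCayleyGraph, SimpleGraph.fromRel_adj]
  constructor
  · rintro ⟨-, h | h⟩
    · cases h with | cone _ _ h => exact h
    · cases h
  · exact fun h => ⟨by simp, Or.inl (.cone _ _ h)⟩

theorem not_adj_inr_inr {A B : Σ i, G ⧸ P i} :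
    ¬ (conedOffCayleyGraph P S).Adj (Sum.inr A) (Sum.inr B) := by
  rw [conedOffCayleyGraph, SimpleGraph.fromRel_adj]
  rintro ⟨-, h | h⟩ <;> cases h

/-- The walk avoids the cone vertices. -/
def AvoidsCones {v w : ConedVertex P} (p : (conedOffCayleyGraph P S).Walk v w) : Prop :=
  p.support.countP Sum.isRight = 0

theorem AvoidsCones.append {v w x : ConedVertex P} {p : (conedOffCayleyGraph P S).Walk v w}
    {q : (conedOffCayleyGraph P S).Walk w x} (hp : AvoidsCones p) (hq : AvoidsCones q) :
    AvoidsCones (p.append q) := by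
  unfold AvoidsCones at *
  rw [← q.cons_tail_support, List.countP_cons] at hq
  rw [SimpleGraph.Walk.support_append, List.countP_append]
  omega

theorem AvoidsCones.reverse {v w : ConedVertex P} {p : (conedOffCayleyGraph P S).Walk v w}
    (hp : AvoidsCones p) : AvoidsCones p.reverse := by
  unfold AvoidsCones at *
  rwa [SimpleGraph.Walk.support_reverse, List.countP_reverse]

/-- If `S` generates, every element is the total displacement of walks of bounded length that start
anywhere and avoid the cone vertices. -/
theorem exists_avoidsCones_walk (hgen : Subgroup.closure S = ⊤) (x : G) :
    ∃ n, ∀ g : G, ∃ p : (conedOffCayleyGraph P S).Walk (Sum.inl g) (Sum.inl (g * x)),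
      AvoidsCones p ∧ p.length ≤ n := by
  have hx : x ∈ Subgroup.closure S := hgen ▸ Subgroup.mem_top x
  induction hx using Subgroup.closure_induction with
  | mem s hs =>
    refine ⟨1, fun g => ?_⟩
    -- A trivial generator gives no edge, since the graph is simplicial.
    by_cases h : g = g * s
    · rw [← h]
      exact ⟨.nil, by simp [AvoidsCones], by simp⟩
    · have hadj : (conedOffCayleyGraph P S).Adj (Sum.inl g) (Sum.inl (g * s)) :=
        adj_inl_inl.2 ⟨h, Or.inl (by rwa [inv_mul_cancel_left])⟩
      exact ⟨.cons hadj .nil, by simp [AvoidsCones], by simp⟩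
  | one =>
    refine ⟨0, fun g => ?_⟩
    rw [mul_one]
    exact ⟨.nil, by simp [AvoidsCones], by simp⟩
  | mul x y _ _ ihx ihy =>
    obtain ⟨n, hn⟩ := ihx
    obtain ⟨m, hm⟩ := ihy
    refine ⟨n + m, fun g => ?_⟩
    obtain ⟨p, hp, hpn⟩ := hn g
    obtain ⟨q, hq, hqm⟩ := hm (g * x)
    rw [← mul_assoc]
    refine ⟨p.append q, ?_, ?_⟩
    · exact hp.append hq
    · rw [SimpleGraph.Walk.length_append]
      omega
  | inv x _ ih =>
    obtain ⟨n, hn⟩ := ih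
    refine ⟨n, fun g => ?_⟩
    have h := hn (g * x⁻¹)
    rw [inv_mul_cancel_right] at h
    obtain ⟨p, hp, hpn⟩ := h
    exact ⟨p.reverse, hp.reverse, by rwa [SimpleGraph.Walk.length_reverse]⟩

theorem conedOffCayleyGraph_connected (hgen : Subgroup.closure S = ⊤) :
    (conedOffCayleyGraph P S).Connected := by
  have h1 : ∀ g : G, (conedOffCayleyGraph P S).Reachable (Sum.inl 1) (Sum.inl g) := by
    intro g
    obtain ⟨n, hn⟩ := exists_avoidsCones_walk (P := P) hgen g
    obtain ⟨p, -, -⟩ := hn 1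
    rw [one_mul] at p
    exact ⟨p⟩
  have h2 : ∀ v, (conedOffCayleyGraph P S).Reachable (Sum.inl 1) v := by
    rintro (g | ⟨i, A⟩)
    · exact h1 g
    · obtain ⟨g, rfl⟩ := QuotientGroup.mk_surjective A
      exact (h1 g).trans (SimpleGraph.Adj.reachable (adj_inl_inr.2 rfl))
  exact ⟨fun v w => (h2 v).symm.trans (h2 w)⟩

theorem uniconeLoops_length_pos {l : ℕ} {p : ClosedWalk (conedOffCayleyGraph P S)}
    (hp : p ∈ uniconeLoops P S l) : 0 < p.2.length := hp.1

/-- A labelling that is trivial on the short unicone loops is trivial on the short loops that avoid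
the cone vertices. -/
theorem AvoidsCones.holonomy_eq_one {Q : Type*} [Group Q] {c : ConedVertex P → ConedVertex P → Q}
    {l : ℕ} (hl : ∀ p ∈ uniconeLoops P S l, p.2.holonomy c = 1) {v : ConedVertex P}
    {p : (conedOffCayleyGraph P S).Walk v v} (hp : AvoidsCones p) (hpl : p.length < l) :
    p.holonomy c = 1 := by
  obtain h | h := Nat.eq_zero_or_pos p.length
  · rw [SimpleGraph.Walk.length_eq_zero_iff] at h
    rw [SimpleGraph.Walk.eq_nil_iff_nil.2 h, SimpleGraph.Walk.holonomy_nil]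
  · exact hl ⟨v, p⟩ ⟨h, hpl, (List.Sublist.countP_le (List.tail_sublist _)).trans
      (hp.le.trans zero_le_one)⟩

end ConedOff

end GroupPair

/-! ### From simple connectivity to a finite relative presentation. -/

namespace GroupPair

section ConedOff

variable {G : Type u} {ι : Type v} [Group G] {P : ι → Subgroup G} {S : Set G}

@[simp] theorem relHom_inl_of (s : S) : relHom P S (.inl (.of s)) = s := by
  simp [relHom]

@[simp] theorem relHom_inr_of {i : ι} (x : P i) : relHom P S (.inr (.of x)) = x := by
  simp [relHom]

/-- A subgroup that contains the generators is everything. -/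
theorem eq_top_of_generators_mem {H : Subgroup (RelFree P S)}
    (h1 : ∀ s : S, (.inl (.of s) : RelFree P S) ∈ H)
    (h2 : ∀ i (x : P i), (.inr (.of x) : RelFree P S) ∈ H) : H = ⊤ := by
  refine (Subgroup.eq_top_iff' H).2 fun x => ?_
  induction x using Monoid.Coprod.induction_on with
  | inl f =>
    induction f using FreeGroup.induction_on with
    | C1 => simp
    | of s => exact h1 s
    | inv_of s _ => simpa using h1 s
    | mul x y hx hy => simpa using H.mul_mem hx hy
  | inr f =>
    induction f using Monoid.CoprodI.induction_on with
    | one => simp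
    | of i x => exact h2 i x
    | mul x y hx hy => simpa using H.mul_mem hx hy
  | mul x y hx hy => exact H.mul_mem hx hy

theorem isRelGenerating_of_closure_eq_top (hgen : Subgroup.closure S = ⊤) :
    IsRelGenerating P S := by
  rw [IsRelGenerating, ← MonoidHom.range_eq_top, eq_top_iff, ← hgen, Subgroup.closure_le]
  exact fun s hs => ⟨.inl (.of ⟨s, hs⟩), relHom_inl_of _⟩

/-- The element of the relative free product defined by a word in `S`. -/
def word (P : ι → Subgroup G) (w : List (S × Bool)) : RelFree P S :=
  Monoid.Coprod.inl (FreeGroup.mk w)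

theorem word_append (w w' : List (S × Bool)) : word P (w ++ w') = word P w * word P w' := by
  rw [word, word, word, ← map_mul, FreeGroup.mul_mk]

theorem word_nil : word P ([] : List (S × Bool)) = 1 := map_one _

theorem word_true (s : S) : word P [(s, true)] = .inl (.of s) := rfl

theorem word_false (s : S) : word P [(s, false)] = (.inl (.of s))⁻¹ := by
  rw [← map_inv]
  rfl

/-- The relators of the form `w x`, where `w` is a word in `S` of length at most `n` and `x` is an
element of a member of the collection. -/
def shortRelators (P : ι → Subgroup G) (S : Set G) (n : ℕ) : Set (RelFree P S) :=
  {f | ∃ (w : List (S × Bool)) (i : ι) (x : P i), w.length ≤ n ∧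
    f = word P w * .inr (.of x) ∧ relHom P S f = 1}

/-- The element `x` of a relator `w x` is the inverse of the value of `w` in `G`, so `w` and `i`
determine the relator. Pairs that yield none are sent to the dummy value `1`. -/
theorem finite_shortRelators [Finite ι] (hS : S.Finite) (n : ℕ) :
    (shortRelators P S n).Finite := by
  classical
  have : Finite S := hS
  have hfin : (({w : List (S × Bool) | w.length ≤ n}) ×ˢ (Set.univ : Set ι)).Finite :=
    (List.finite_length_le _ n).prod Set.finite_univ
  refine (hfin.image fun p => if h : (relHom P S (word P p.1))⁻¹ ∈ P p.2 then
    word P p.1 * .inr (.of (⟨_, h⟩ : P p.2)) else 1).subset ?_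
  rintro _ ⟨w, i, x, hw, rfl, h⟩
  rw [map_mul, relHom_inr_of, mul_eq_one_iff_inv_eq] at h
  have hx : (relHom P S (word P w))⁻¹ ∈ P i := h ▸ x.2
  refine ⟨(w, i), ⟨hw, trivial⟩, ?_⟩
  change (if h : (relHom P S (word P w))⁻¹ ∈ P i then _ else _) = _
  rw [dif_pos hx]
  congr 3
  exact Subtype.ext h

variable (P S) in
/-- The group defined by the relators of bounded length. -/
abbrev ShortQuotient (n : ℕ) : Type _ := RelFree P S ⧸ Subgroup.normalClosure (shortRelators P S n)

theorem mk_word_mul_eq_one {n : ℕ} {w : List (S × Bool)} (hw : w.length ≤ n) {i : ι} (x : P i)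
    (h : relHom P S (word P w) * x = 1) :
    ((word P w * .inr (.of x) : RelFree P S) : ShortQuotient P S n) = 1 := by
  rw [QuotientGroup.eq_one_iff]
  exact Subgroup.subset_normalClosure ⟨w, i, x, hw, rfl, by rw [map_mul, relHom_inr_of, h]⟩

/-- A word alone is a short relator with trivial member part, which requires some index to exist. -/
theorem mk_word_eq_one [Nonempty ι] {n : ℕ} {w : List (S × Bool)} (hw : w.length ≤ n)
    (h : relHom P S (word P w) = 1) : ((word P w : RelFree P S) : ShortQuotient P S n) = 1 := by
  have := mk_word_mul_eq_one hw (1 : P (Classical.arbitrary ι)) (by rw [h]; simp)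
  simpa using this

theorem normalClosure_shortRelators_le (n : ℕ) :
    Subgroup.normalClosure (shortRelators P S n) ≤ (relHom P S).ker :=
  Subgroup.normalClosure_le_normal fun _ ⟨_, _, _, _, _, h⟩ => h

/-- The factor of `g` in the coset `A`, relative to a fixed representative. -/
theorem inv_mul_out_mem {g : G} {A : Σ i, G ⧸ P i} (h : (g : G ⧸ P A.1) = A.2) :
    g⁻¹ * A.2.out ∈ P A.1 := by
  rw [← QuotientGroup.eq, h, QuotientGroup.out_eq']

variable (P S) in
open Classical in
/-- The label of the edge from a group element to a cone vertex. -/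
noncomputable def coneLabel (n : ℕ) (g : G) (A : Σ i, G ⧸ P i) : ShortQuotient P S n :=
  if h : (g : G ⧸ P A.1) = A.2 then
    ((.inr (.of (⟨_, inv_mul_out_mem h⟩ : P A.1)) : RelFree P S) : ShortQuotient P S n)
  else 1

variable (P S) in
open Classical in
/-- The tautological labelling of the coned-off Cayley graph. -/
noncomputable def tautLabel (n : ℕ) : ConedVertex P → ConedVertex P → ShortQuotient P S n
  | Sum.inl g, Sum.inl g' =>
    if h : g⁻¹ * g' ∈ S then ((word P [(⟨_, h⟩, true)] : RelFree P S) : ShortQuotient P S n)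
    else if h : g'⁻¹ * g ∈ S then ((word P [(⟨_, h⟩, false)] : RelFree P S) : ShortQuotient P S n)
    else 1
  | Sum.inl g, Sum.inr A => coneLabel P S n g A
  | Sum.inr A, Sum.inl g => (coneLabel P S n g A)⁻¹
  | Sum.inr _, Sum.inr _ => 1

variable {n : ℕ}

theorem relHom_word_true (s : S) : relHom P S (word P [(s, true)]) = s := by
  rw [word_true, relHom_inl_of]

theorem relHom_word_false (s : S) : relHom P S (word P [(s, false)]) = (s : G)⁻¹ := by
  rw [word_false, map_inv, relHom_inl_of]

/-- The labels of the edges of the Cayley graph. -/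
theorem exists_tautLabel_eq_word {g g' : G}
    (h : (conedOffCayleyGraph P S).Adj (Sum.inl g) (Sum.inl g')) :
    ∃ a : S × Bool, tautLabel P S n (Sum.inl g) (Sum.inl g') = (word P [a] : RelFree P S) ∧
      relHom P S (word P [a]) = g⁻¹ * g' := by
  rw [tautLabel]
  split_ifs with h1 h2
  · exact ⟨_, rfl, relHom_word_true _⟩
  · refine ⟨_, rfl, ?_⟩
    rw [relHom_word_false]
    simp
  · exact absurd (adj_inl_inl.1 h).2 (by tauto)

/-- When both `s` and `s⁻¹` lie in `S`, each orientation of an edge is labelled by its own positive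
letter. The labels are then inverse only modulo a relator of length two, whence the bound on `n`. -/
theorem tautLabel_symm [Nonempty ι] (hn : 2 ≤ n) (v w : ConedVertex P)
    (h : (conedOffCayleyGraph P S).Adj v w) :
    tautLabel P S n w v = (tautLabel P S n v w)⁻¹ := by
  obtain g | A := v <;> obtain g' | B := w
  · obtain ⟨a, ha, ha'⟩ := exists_tautLabel_eq_word (n := n) h
    obtain ⟨b, hb, hb'⟩ := exists_tautLabel_eq_word (n := n) h.symm
    rw [ha, hb, eq_inv_iff_mul_eq_one, ← QuotientGroup.mk_mul, ← word_append]
    refine mk_word_eq_one (by simpa using hn) ?_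
    rw [word_append, map_mul, ha', hb']
    group
  · rfl
  · exact (inv_inv _).symm
  · exact (not_adj_inr_inr h).elim

/-- Passing through a cone vertex. -/
theorem coneLabel_inv_mul_coneLabel {g g' : G} {A : Σ i, G ⧸ P i} (h : (g : G ⧸ P A.1) = A.2)
    (h' : (g' : G ⧸ P A.1) = A.2) :
    coneLabel P S n g A * (coneLabel P S n g' A)⁻¹ =
      ((.inr (.of (⟨g⁻¹ * g', QuotientGroup.eq.1 (h.trans h'.symm)⟩ : P A.1)) : RelFree P S) :
        ShortQuotient P S n) := by
  rw [coneLabel, coneLabel, dif_pos h, dif_pos h', ← QuotientGroup.mk_inv, ← QuotientGroup.mk_mul,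
    ← map_inv, ← map_mul, ← map_inv, ← map_mul]
  congr 3
  ext
  simp only [Subgroup.coe_mul, Subgroup.coe_inv]
  group

/-- The label of a walk that avoids the cone vertices is the word that it spells. -/
theorem AvoidsCones.exists_word {v w : ConedVertex P} {p : (conedOffCayleyGraph P S).Walk v w}
    (hp : AvoidsCones p) : ∃ (g g' : G) (a : List (S × Bool)), v = Sum.inl g ∧ w = Sum.inl g' ∧
      a.length = p.length ∧ p.holonomy (tautLabel P S n) = (word P a : RelFree P S) ∧
      relHom P S (word P a) = g⁻¹ * g' := by
  induction p with
  | @nil v =>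
    obtain g | A := v
    · exact ⟨g, g, [], rfl, rfl, rfl, by rw [word_nil]; rfl, by rw [word_nil]; simp⟩
    · simp [AvoidsCones] at hp
  | @cons v x w h p ih =>
    rw [AvoidsCones, SimpleGraph.Walk.support_cons, List.countP_cons] at hp
    obtain ⟨g₁, g', a, rfl, hw, ha, hhol, hrel⟩ := ih (by unfold AvoidsCones; omega)
    obtain g | A := v
    · obtain ⟨b, hb, hb'⟩ := exists_tautLabel_eq_word (n := n) h
      refine ⟨g, g', b :: a, rfl, hw, by simp [ha], ?_, ?_⟩
      · rw [SimpleGraph.Walk.holonomy_cons, hb, hhol, ← QuotientGroup.mk_mul, ← word_append]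
        rfl
      · rw [← List.singleton_append, word_append, map_mul, hb', hrel]
        group
    · simp at hp

/-- The labels of the short unicone loops are trivial. -/
theorem holonomy_tautLabel_eq_one [Nonempty ι] {p : ClosedWalk (conedOffCayleyGraph P S)}
    (hp : p ∈ uniconeLoops P S n) : p.2.holonomy (tautLabel P S n) = 1 := by
  classical
  obtain ⟨v, p⟩ := p
  obtain ⟨hpos, hlen, hcount⟩ := hp
  change 0 < p.length at hpos
  change p.length < n at hlen
  change p.support.tail.countP Sum.isRight ≤ 1 at hcount
  change p.holonomy (tautLabel P S n) = 1
  by_cases hA : ∃ A, Sum.inr A ∈ p.support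
  · obtain ⟨A, hA⟩ := hA
    have hspec := p.take_spec hA
    have hholp := congrArg (fun q => q.holonomy (tautLabel P S n)) hspec
    set q := p.takeUntil _ hA
    set r := p.dropUntil _ hA
    -- Rotate the loop so that it starts at the cone vertex. Length and number of cone vertices are
    -- unchanged, and the holonomy changes by conjugation.
    have hlen' : (r.append q).length = p.length := by
      rw [← hspec, SimpleGraph.Walk.length_append, SimpleGraph.Walk.length_append, add_comm]
    have hcount' : (r.append q).support.tail.countP Sum.isRight ≤ 1 := by
      rw [← hspec, SimpleGraph.Walk.tail_support_append, List.countP_append] at hcount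
      rw [SimpleGraph.Walk.tail_support_append, List.countP_append]
      omega
    have hhol' : (r.append q).holonomy (tautLabel P S n) = 1 →
        p.holonomy (tautLabel P S n) = 1 := by
      rw [← hholp]
      simp only [SimpleGraph.Walk.holonomy_append]
      intro h
      rw [mul_eq_one_iff_eq_inv] at h
      rw [h, mul_inv_cancel]
    apply hhol'
    generalize r.append q = s at *
    cases s with
    | nil =>
      simp at hlen'
      omega
    | @cons _ x _ hx s =>
      obtain g | B := x
      swap
      · exact (not_adj_inr_inr hx).elim
      obtain ⟨y, s', hy, hs⟩ : ∃ (y : ConedVertex P)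
          (s' : (conedOffCayleyGraph P S).Walk (Sum.inl g) y)
          (hy : (conedOffCayleyGraph P S).Adj y (Sum.inr A)), s = s'.concat hy := by
        cases s with
        | cons h s =>
          obtain ⟨y, s', hy, hs⟩ := SimpleGraph.Walk.exists_cons_eq_concat h s
          exact ⟨y, s', hy, hs⟩
      subst hs
      -- The final return to `A` already accounts for the only cone vertex allowed.
      have hs' : AvoidsCones s' := by
        unfold AvoidsCones
        rw [SimpleGraph.Walk.support_cons, List.tail_cons, SimpleGraph.Walk.support_concat,
          List.countP_append] at hcount'
        simpa using hcount'
      obtain ⟨_, g', a, hg, rfl, ha, hhol, hrel⟩ := hs'.exists_word (n := n)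
      obtain rfl := Sum.inl_injective hg
      rw [SimpleGraph.Walk.holonomy_cons, SimpleGraph.Walk.holonomy_concat, hhol]
      change (coneLabel P S n g A)⁻¹ * (_ * coneLabel P S n g' A) = 1
      have hg := adj_inl_inr.1 hx.symm
      have hg' := adj_inl_inr.1 hy
      -- Cyclically permuted, the label is the word of the cone-free part times the element `g'⁻¹ g`
      -- of `P A.1`, that is, a short relator.
      rw [inv_mul_eq_one, eq_comm, ← mul_inv_eq_one, mul_assoc,
        coneLabel_inv_mul_coneLabel hg' hg, ← QuotientGroup.mk_mul]
      refine mk_word_mul_eq_one ?_ _ ?_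
      · simp at hlen'
        omega
      · rw [hrel]
        group
  · have hav : AvoidsCones p := by
      rw [AvoidsCones, List.countP_eq_zero]
      rintro (g | A) h
      · simp
      · exact (hA ⟨A, h⟩).elim
    obtain ⟨g, g', a, rfl, hg', ha, hhol, hrel⟩ := hav.exists_word (n := n)
    obtain rfl := Sum.inl_injective hg'
    rw [hhol]
    exact mk_word_eq_one (by omega) (by rw [hrel]; simp)

/-- Each element of the relative free product labels walks that start anywhere. -/
theorem exists_walk_holonomy_eq [Nonempty ι] (hn : 2 ≤ n) (f : RelFree P S) (g : G) :
    ∃ p : (conedOffCayleyGraph P S).Walk (Sum.inl g) (Sum.inl (g * relHom P S f)),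
      p.holonomy (tautLabel P S n) = f := by
  let H : Subgroup (RelFree P S) :=
    { carrier := {f | ∀ g : G, ∃ p : (conedOffCayleyGraph P S).Walk (Sum.inl g)
        (Sum.inl (g * relHom P S f)), p.holonomy (tautLabel P S n) = f}
      one_mem' := by
        intro g
        rw [map_one, mul_one]
        exact ⟨.nil, rfl⟩
      mul_mem' := by
        intro a b ha hb g
        obtain ⟨p, hp⟩ := ha g
        obtain ⟨q, hq⟩ := hb (g * relHom P S a)
        rw [map_mul, ← mul_assoc]
        exact ⟨p.append q, by rw [SimpleGraph.Walk.holonomy_append, hp, hq, QuotientGroup.mk_mul]⟩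
      inv_mem' := by
        intro a ha g
        have h := ha (g * relHom P S a⁻¹)
        rw [mul_assoc, ← map_mul, inv_mul_cancel, map_one, mul_one] at h
        obtain ⟨p, hp⟩ := h
        refine ⟨p.reverse, ?_⟩
        rw [SimpleGraph.Walk.holonomy_reverse (tautLabel_symm hn), hp, QuotientGroup.mk_inv] }
  suffices h : H = ⊤ from (h ▸ Subgroup.mem_top f : f ∈ H) g
  refine eq_top_of_generators_mem (fun s g => ?_) (fun i x g => ?_)
  · rw [relHom_inl_of]
    by_cases h : g = g * s
    · rw [← h]
      -- Here `s = 1` in `G`: no edge is crossed, and the one-letter word is itself a short relator.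
      refine ⟨.nil, (mk_word_eq_one (w := [(s, true)]) (by simp; omega) ?_).symm⟩
      rw [relHom_word_true]
      exact mul_eq_left.1 h.symm
    · have hs : g⁻¹ * (g * s) ∈ S := by
        rw [inv_mul_cancel_left]
        exact s.2
      refine ⟨.cons (adj_inl_inl.2 ⟨h, Or.inl hs⟩) .nil, ?_⟩
      rw [SimpleGraph.Walk.holonomy_cons, SimpleGraph.Walk.holonomy_nil, mul_one, tautLabel,
        dif_pos hs, word_true]
      congr 3
      exact Subtype.ext (inv_mul_cancel_left _ _)
  · rw [relHom_inr_of]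
    let A : Σ i, G ⧸ P i := ⟨i, g⟩
    have h : (g : G ⧸ P A.1) = A.2 := rfl
    have h' : ((g * x : G) : G ⧸ P A.1) = A.2 :=
      (QuotientGroup.eq.2 (by rw [inv_mul_cancel_left]; exact x.2)).symm
    refine ⟨.cons (adj_inl_inr.2 h) (.cons (adj_inl_inr.2 h').symm .nil), ?_⟩
    rw [SimpleGraph.Walk.holonomy_cons, SimpleGraph.Walk.holonomy_cons,
      SimpleGraph.Walk.holonomy_nil, mul_one]
    refine (coneLabel_inv_mul_coneLabel h h').trans ?_
    congr 3
    exact Subtype.ext (inv_mul_cancel_left _ _)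

/-- If the coned-off Cayley graph is coarsely unicone simply connected, the pair is relatively
finitely presented. -/
theorem relFinitelyPresented_of_coarselyUniconeSimplyConnected [Finite ι] [Nonempty ι]
    (hS : S.Finite) (hgen : Subgroup.closure S = ⊤) (h : CoarselyUniconeSimplyConnected P S) :
    RelFinitelyPresented P := by
  obtain ⟨l, hl⟩ := h
  rw [simplyConnectedSpace_twoComplex_iff (fun p hp => uniconeLoops_length_pos hp)
    (conedOffCayleyGraph_connected hgen)] at hl
  -- The bound `l + 2` covers the unicone loops of length less than `l` and is at least `2`, as
  -- `tautLabel_symm` demands.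
  refine ⟨S, hS, isRelGenerating_of_closure_eq_top hgen, shortRelators P S (l + 2),
    finite_shortRelators hS _, le_antisymm (normalClosure_shortRelators_le _) fun f hf => ?_⟩
  obtain ⟨p, hp⟩ := exists_walk_holonomy_eq (n := l + 2) (by omega) f 1
  have key := hl (ShortQuotient P S (l + 2)) (tautLabel P S (l + 2)) (tautLabel_symm (by omega))
    fun q hq => holonomy_tautLabel_eq_one ⟨hq.1, hq.2.1.trans (by omega), hq.2.2⟩
  rw [MonoidHom.mem_ker] at hf
  rw [← QuotientGroup.eq_one_iff, ← hp]
  have hx : ∀ x : G, x = 1 → ∀ q : (conedOffCayleyGraph P S).Walk (Sum.inl 1) (Sum.inl (1 * x)),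
      q.holonomy (tautLabel P S (l + 2)) = 1 := by
    rintro _ rfl
    rw [mul_one]
    exact key _
  exact hx _ hf p

end ConedOff

end GroupPair

/-! ### From a finite relative presentation to simple connectivity. -/

namespace GroupPair

/-- The permutation of a trivial covering of `G` that moves the base by right multiplication by
`x⁻¹` and changes the sheets by `k`. -/
def sheetPerm {G Q : Type*} [Group G] [Group Q] (x : G) (k : G → Q) : Equiv.Perm (G × Q) where
  toFun a := (a.1 * x⁻¹, a.2 * k a.1)
  invFun a := (a.1 * x, a.2 * (k (a.1 * x))⁻¹)
  left_inv a := by simp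
  right_inv a := by simp

section ConedOff

variable {G : Type u} {ι : Type v} [Group G] {P : ι → Subgroup G} {S S₀ : Set G}

section Action

variable {Q : Type w} [Group Q] (c : ConedVertex P → ConedVertex P → Q)
  (hc : ∀ v w, (conedOffCayleyGraph P S).Adj v w → c w v = (c v w)⁻¹)
  (W : ∀ (s : S₀) (g : G), (conedOffCayleyGraph P S).Walk (Sum.inl g) (Sum.inl (g * (s : G)⁻¹)))

theorem cone_mul_eq {i : ι} (x : P i) (g : G) :
    (⟨i, ((g * (x : G)⁻¹ : G) : G ⧸ P i)⟩ : Σ i, G ⧸ P i) = ⟨i, (g : G ⧸ P i)⟩ := by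
  congr 1
  rw [QuotientGroup.eq]
  simp

/-- A member of the collection acts by transport through the cone vertices. -/
def memberAction (i : ι) : P i →* Equiv.Perm (G × Q) where
  toFun x := sheetPerm (x : G) fun g =>
    c (Sum.inl g) (Sum.inr ⟨i, g⟩) * c (Sum.inr ⟨i, g⟩) (Sum.inl (g * (x : G)⁻¹))
  map_one' := by
    ext ⟨g, q⟩
    · simp [sheetPerm]
    · have h : (conedOffCayleyGraph P S).Adj (Sum.inl g) (Sum.inr ⟨i, g⟩) := adj_inl_inr.2 rfl
      simp [sheetPerm, hc _ _ h]
  -- Consecutive moves by members of `P i` pass through the same cone vertex, so the way in and the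
  -- way out in the middle cancel.
  map_mul' x y := by
    ext ⟨g, q⟩
    · simp [sheetPerm, mul_assoc]
    · have h : (conedOffCayleyGraph P S).Adj (Sum.inl (g * (y : G)⁻¹)) (Sum.inr ⟨i, g⟩) :=
        adj_inl_inr.2 (eq_of_heq (Sigma.mk.inj (cone_mul_eq y g)).2)
      simp only [sheetPerm, Equiv.Perm.coe_mul, Function.comp_apply, Equiv.coe_fn_mk,
        cone_mul_eq y g, hc _ _ h, Subgroup.coe_mul, mul_inv_rev]
      simp [mul_assoc]

/-- The relative free product acts by transport along walks. -/
def transportAction : RelFree P S₀ →* Equiv.Perm (G × Q) :=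
  Monoid.Coprod.lift (FreeGroup.lift fun s => sheetPerm (s : G) fun g => (W s g).holonomy c)
    (Monoid.CoprodI.lift fun i => memberAction c hc i)

theorem transportAction_inl_of (s : S₀) (g : G) (q : Q) :
    transportAction c hc W (.inl (.of s)) (g, q) = (g * (s : G)⁻¹, q * (W s g).holonomy c) := by
  simp [transportAction, sheetPerm]

theorem transportAction_inr_of {i : ι} (x : P i) (g : G) (q : Q) :
    transportAction c hc W (.inr (.of x)) (g, q) = (g * (x : G)⁻¹,
      q * (c (Sum.inl g) (Sum.inr ⟨i, g⟩) * c (Sum.inr ⟨i, g⟩) (Sum.inl (g * (x : G)⁻¹)))) := by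
  simp [transportAction, memberAction, sheetPerm]

theorem transportAction_fst (x : RelFree P S₀) (a : G × Q) :
    (transportAction c hc W x a).1 = a.1 * (relHom P S₀ x)⁻¹ := by
  let H : Subgroup (RelFree P S₀) :=
    { carrier := {x | ∀ a, (transportAction c hc W x a).1 = a.1 * (relHom P S₀ x)⁻¹}
      one_mem' := fun a => by simp
      mul_mem' := fun {x y} hx hy a => by
        rw [map_mul, map_mul, Equiv.Perm.mul_apply, hx, hy, mul_inv_rev, mul_assoc]
      inv_mem' := fun {x} hx a => by
        have := hx ((transportAction c hc W x)⁻¹ a)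
        rw [← Equiv.Perm.mul_apply, mul_inv_cancel, Equiv.Perm.one_apply] at this
        rw [map_inv, this, map_inv, inv_inv, inv_mul_cancel_right] }
  suffices h : H = ⊤ from (h ▸ Subgroup.mem_top x : x ∈ H) a
  refine eq_top_of_generators_mem (fun s a => ?_) (fun i x a => ?_)
  · rw [← Prod.mk.eta (p := a), transportAction_inl_of, relHom_inl_of]
  · rw [← Prod.mk.eta (p := a), transportAction_inr_of, relHom_inr_of]

end Action

/-- For labellings that are trivial on the unicone loops of length less than `n`, the action of `x`
is transport along walks of length at most `n` that avoid the cone vertices. -/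
def IsTransport (W : ∀ (s : S₀) (g : G),
    (conedOffCayleyGraph P S).Walk (Sum.inl g) (Sum.inl (g * (s : G)⁻¹)))
    (n : ℕ) (x : RelFree P S₀) : Prop :=
  ∀ (Q : Type w) [Group Q] (c : ConedVertex P → ConedVertex P → Q)
    (hc : ∀ v w, (conedOffCayleyGraph P S).Adj v w → c w v = (c v w)⁻¹),
    (∀ p ∈ uniconeLoops P S n, p.2.holonomy c = 1) → ∀ g g' : G, g' * relHom P S₀ x = g →
      ∃ p : (conedOffCayleyGraph P S).Walk (Sum.inl g) (Sum.inl g'), AvoidsCones p ∧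
        p.length ≤ n ∧ ∀ q, transportAction c hc W x (g, q) = (g', q * p.holonomy c)

section Transport

variable {W : ∀ (s : S₀) (g : G),
  (conedOffCayleyGraph P S).Walk (Sum.inl g) (Sum.inl (g * (s : G)⁻¹))}

/-- The elements with this property form a subgroup: bounds add under products and persist under
inverses. For a member element, the path through the cone is traded for a cone-free walk, the two
together bounding a unicone loop. The bound is fixed before the labelling is chosen. -/
theorem exists_isTransport (hgen : Subgroup.closure S = ⊤)
    (hW : ∀ s, ∃ n, ∀ g, AvoidsCones (W s g) ∧ (W s g).length ≤ n) (x : RelFree P S₀) :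
    ∃ n, IsTransport.{u, v, w} W n x := by
  let H : Subgroup (RelFree P S₀) :=
    { carrier := {x | ∃ n, IsTransport.{u, v, w} W n x}
      one_mem' := by
        refine ⟨0, fun Q _ c hc hl g g' hg => ?_⟩
        rw [map_one, mul_one] at hg
        subst hg
        exact ⟨.nil, by simp [AvoidsCones], le_rfl, fun q => by simp⟩
      mul_mem' := by
        rintro x y ⟨n, hx⟩ ⟨m, hy⟩
        refine ⟨n + m, fun Q _ c hc hl g g' hg => ?_⟩
        rw [map_mul, ← mul_assoc] at hg
        obtain ⟨p, hp, hpn, hpq⟩ := hy Q c hc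
          (fun p hp => hl p ⟨hp.1, by have := hp.2.1; omega, hp.2.2⟩) g _ hg
        obtain ⟨r, hr, hrn, hrq⟩ := hx Q c hc
          (fun p hp => hl p ⟨hp.1, by have := hp.2.1; omega, hp.2.2⟩) _ g' rfl
        refine ⟨p.append r, hp.append hr, ?_, fun q => ?_⟩
        · rw [SimpleGraph.Walk.length_append]
          omega
        · rw [map_mul, Equiv.Perm.mul_apply, hpq, hrq, SimpleGraph.Walk.holonomy_append,
            mul_assoc]
      inv_mem' := by
        rintro x ⟨n, hx⟩
        refine ⟨n, fun Q _ c hc hl g g' hg => ?_⟩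
        rw [map_inv, mul_inv_eq_iff_eq_mul] at hg
        obtain ⟨p, hp, hpn, hpq⟩ := hx Q c hc hl g' g hg.symm
        refine ⟨p.reverse, hp.reverse, by rwa [SimpleGraph.Walk.length_reverse], fun q => ?_⟩
        rw [map_inv, Equiv.Perm.inv_eq_iff_eq, hpq, SimpleGraph.Walk.holonomy_reverse hc,
          inv_mul_cancel_right] }
  suffices h : H = ⊤ from (h ▸ Subgroup.mem_top x : x ∈ H)
  refine eq_top_of_generators_mem (fun s => ?_) (fun i x => ?_)
  · obtain ⟨n, hn⟩ := hW s
    refine ⟨n, fun Q _ c hc hl g g' hg => ?_⟩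
    rw [relHom_inl_of] at hg
    obtain rfl := eq_mul_inv_of_mul_eq hg
    exact ⟨W s g, (hn g).1, (hn g).2, transportAction_inl_of c hc W s g⟩
  · obtain ⟨n, hn⟩ := exists_avoidsCones_walk (P := P) hgen (x : G)⁻¹
    -- The comparison loop has two cone edges and at most `n` others, so its length is less than `n
    -- + 3`.
    refine ⟨n + 3, fun Q _ c hc hl g g' hg => ?_⟩
    rw [relHom_inr_of] at hg
    obtain rfl := eq_mul_inv_of_mul_eq hg
    obtain ⟨p, hp, hpn⟩ := hn g
    refine ⟨p, hp, by omega, fun q => ?_⟩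
    have h : (conedOffCayleyGraph P S).Adj (Sum.inl g) (Sum.inr ⟨i, g⟩) := adj_inl_inr.2 rfl
    have h' : (conedOffCayleyGraph P S).Adj (Sum.inl (g * (x : G)⁻¹)) (Sum.inr ⟨i, g⟩) :=
      adj_inl_inr.2 (eq_of_heq (Sigma.mk.inj (cone_mul_eq x g)).2)
    have hloop := hl ⟨_, .cons h (.cons h'.symm p.reverse)⟩ ⟨by simp, by simp; omega, by
      have h0 : p.reverse.support.countP Sum.isRight = 0 := hp.reverse
      rw [SimpleGraph.Walk.support_cons, List.tail_cons, SimpleGraph.Walk.support_cons,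
        List.countP_cons, h0]
      simp⟩
    rw [SimpleGraph.Walk.holonomy_cons, SimpleGraph.Walk.holonomy_cons,
      SimpleGraph.Walk.holonomy_reverse hc, ← mul_assoc, mul_inv_eq_one] at hloop
    rw [transportAction_inr_of, hloop]

end Transport

section Potential

variable {Q : Type w} [Group Q] (c : ConedVertex P → ConedVertex P → Q)
  (hc : ∀ v w, (conedOffCayleyGraph P S).Adj v w → c w v = (c v w)⁻¹)
  (W : ∀ (s : S₀) (g : G), (conedOffCayleyGraph P S).Walk (Sum.inl g) (Sum.inl (g * (s : G)⁻¹)))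

/-- The point of the trivial covering lies in the orbit that is seen from the sheet `q` over the
vertex. -/
def InOrbit (z : G × Q) : ConedVertex P → Q → Prop
  | Sum.inl g, q => ∃ x, transportAction c hc W x (g, q) = z
  | Sum.inr A, q => ∃ g : G, (g : G ⧸ P A.1) = A.2 ∧
      ∃ x, transportAction c hc W x (g, q * c (Sum.inr A) (Sum.inl g)) = z

variable {c hc W}

/-- Crossing an edge is undone by an element of the relative free product: a lift of a generator for
a Cayley edge, a member element for leaving a cone vertex. Composing with it keeps the target `z`.
-/
theorem InOrbit.step
    (hS : ∀ s ∈ S, ∃ y, ∀ g g' : G, g' = g * s →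
      (conedOffCayleyGraph P S).Adj (Sum.inl g) (Sum.inl g') →
      ∀ q, transportAction c hc W y (g, q) = (g', q * c (Sum.inl g) (Sum.inl g')))
    {z : G × Q} {v w : ConedVertex P} {q : Q} (hz : InOrbit c hc W z v q)
    (h : (conedOffCayleyGraph P S).Adj v w) : InOrbit c hc W z w (q * c v w) := by
  obtain g | A := v <;> obtain g' | B := w
  · obtain ⟨x, rfl⟩ := hz
    obtain hs | hs := (adj_inl_inl.1 h).2
    · obtain ⟨y, hy⟩ := hS _ hs
      refine ⟨x * y⁻¹, ?_⟩
      rw [map_mul, map_inv, Equiv.Perm.mul_apply, ← hy g g' (by group) h q,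
        Equiv.Perm.inv_eq_iff_eq.2 rfl]
    · obtain ⟨y, hy⟩ := hS _ hs
      refine ⟨x * y, ?_⟩
      rw [map_mul, Equiv.Perm.mul_apply, hy g' g (by group) h.symm, hc _ _ h,
        mul_inv_cancel_right]
  · obtain ⟨x, rfl⟩ := hz
    exact ⟨g, adj_inl_inr.1 h, x, by rw [hc _ _ h, mul_inv_cancel_right]⟩
  · obtain ⟨g, hg, x, rfl⟩ := hz
    obtain ⟨i, A⟩ := A
    have hg' := adj_inl_inr.1 h.symm
    change (g : G ⧸ P i) = A at hg
    change (g' : G ⧸ P i) = A at hg'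
    subst hg'
    refine ⟨x * .inr (.of (⟨g⁻¹ * g', QuotientGroup.eq.1 hg⟩ : P i)), ?_⟩
    rw [map_mul, Equiv.Perm.mul_apply, transportAction_inr_of, hc _ _ h]
    have : g' * (g⁻¹ * g')⁻¹ = g := by group
    simp only [this]
    congr 2
    group
  · exact (not_adj_inr_inr h).elim

theorem InOrbit.walk
    (hS : ∀ s ∈ S, ∃ y, ∀ g g' : G, g' = g * s →
      (conedOffCayleyGraph P S).Adj (Sum.inl g) (Sum.inl g') →
      ∀ q, transportAction c hc W y (g, q) = (g', q * c (Sum.inl g) (Sum.inl g')))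
    {z : G × Q} {v w : ConedVertex P} (p : (conedOffCayleyGraph P S).Walk v w) {q : Q}
    (hz : InOrbit c hc W z v q) : InOrbit c hc W z w (q * p.holonomy c) := by
  induction p generalizing q with
  | nil => rwa [SimpleGraph.Walk.holonomy_nil, mul_one]
  | cons h p ih =>
    rw [SimpleGraph.Walk.holonomy_cons, ← mul_assoc]
    exact ih (hz.step hS h)

end Potential

/-- If the pair is relatively finitely presented, the coned-off Cayley graph is coarsely unicone
simply connected. -/
theorem coarselyUniconeSimplyConnected_of_relFinitelyPresented
    (hS : S.Finite) (hgen : Subgroup.closure S = ⊤) (h : RelFinitelyPresented P) :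
    CoarselyUniconeSimplyConnected P S := by
  obtain ⟨S₀, -, hS₀, R, hR, hker⟩ := h
  choose N hN using fun s : S₀ => exists_avoidsCones_walk (P := P) hgen (s : G)⁻¹
  choose W hW using hN
  choose n hn using exists_isTransport.{u, v, max u v} hgen fun s => ⟨N s, hW s⟩
  choose y hy using hS₀
  obtain ⟨B₁, hB₁⟩ := (hR.image n).bddAbove
  obtain ⟨B₂, hB₂⟩ := (hS.image fun s => n (y s⁻¹)).bddAbove
  -- `B₁` bounds the closed walks that realize the relators, and `B₂` the walks that realize the
  -- generators in `S`. The latter are closed up by one more edge, and the inequality on lengths is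
  -- strict.
  refine ⟨max B₁ B₂ + 2, ?_⟩
  rw [simplyConnectedSpace_twoComplex_iff (fun p hp => uniconeLoops_length_pos hp)
    (conedOffCayleyGraph_connected hgen)]
  intro Q _ c hc hl
  have hl' : ∀ m ≤ max B₁ B₂, ∀ p ∈ uniconeLoops P S m, p.2.holonomy c = 1 := fun m hm p hp =>
    hl p ⟨hp.1, by have := hp.2.1; omega, hp.2.2⟩
  have hrel : ∀ x, relHom P S₀ x = 1 → transportAction c hc W x = 1 := by
    have hle : Subgroup.normalClosure R ≤ (transportAction c hc W).ker := by
      refine Subgroup.normalClosure_le_normal fun r hr => ?_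
      have hr1 : relHom P S₀ r = 1 := by
        rw [← MonoidHom.mem_ker, ← hker]
        exact Subgroup.subset_normalClosure hr
      have hm : n r ≤ max B₁ B₂ := (hB₁ ⟨r, hr, rfl⟩).trans (le_max_left _ _)
      refine Equiv.ext fun ⟨g, q⟩ => ?_
      obtain ⟨p, hp, hpn, hpq⟩ := hn r Q c hc (hl' _ hm) g g (by rw [hr1, mul_one])
      rw [hpq, hp.holonomy_eq_one hl (by omega), mul_one, Equiv.Perm.one_apply]
    exact fun x hx => hle (hker ▸ hx)
  have hstep : ∀ s ∈ S, ∃ y, ∀ g g' : G, g' = g * s →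
      (conedOffCayleyGraph P S).Adj (Sum.inl g) (Sum.inl g') →
      ∀ q, transportAction c hc W y (g, q) = (g', q * c (Sum.inl g) (Sum.inl g')) := by
    -- The base moves by right multiplication by the inverse, so a lift of `s⁻¹` moves `g` to `g *
    -- s`.
    refine fun s hs => ⟨y s⁻¹, fun g g' hg h q => ?_⟩
    have hm : n (y s⁻¹) ≤ max B₁ B₂ := (hB₂ ⟨s, hs, rfl⟩).trans (le_max_right _ _)
    obtain ⟨p, hp, hpn, hpq⟩ := hn (y s⁻¹) Q c hc (hl' _ hm) g g'
      (by rw [hy, hg, mul_inv_cancel_right])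
    have hav : AvoidsCones (.cons h .nil : (conedOffCayleyGraph P S).Walk _ _) := by
      simp [AvoidsCones]
    have hloop := (hp.append hav.reverse).holonomy_eq_one hl (by simp; omega)
    rw [SimpleGraph.Walk.holonomy_append, SimpleGraph.Walk.holonomy_reverse hc, mul_inv_eq_one,
      SimpleGraph.Walk.holonomy_cons, SimpleGraph.Walk.holonomy_nil, mul_one] at hloop
    rw [hpq, hloop]
  have hclosed : ∀ (g : G) (p : (conedOffCayleyGraph P S).Walk (Sum.inl g) (Sum.inl g)),
      p.holonomy c = 1 := by
    intro g p
    -- Following the closed walk yields an `x` that carries the end of the lifted walk back to its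
    -- start. It fixes the base point `g`, so it lies in the kernel and acts trivially.
    have hz : InOrbit c hc W (g, 1) (Sum.inl g) 1 := ⟨1, by simp⟩
    obtain ⟨x, hx⟩ := hz.walk hstep p
    have hx1 := congrArg Prod.fst hx
    rw [transportAction_fst, mul_eq_left, inv_eq_one] at hx1
    rw [hrel x hx1, Equiv.Perm.one_apply, one_mul] at hx
    exact congrArg Prod.snd hx
  rintro (g | ⟨i, A⟩) p
  · exact hclosed g p
  · obtain ⟨g, rfl⟩ := QuotientGroup.mk_surjective A
    have h : (conedOffCayleyGraph P S).Adj (Sum.inl g) (Sum.inr ⟨i, g⟩) := adj_inl_inr.2 rfl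
    have := hclosed g (.cons h (p.concat h.symm))
    rwa [SimpleGraph.Walk.holonomy_cons, SimpleGraph.Walk.holonomy_concat, hc _ _ h, ← mul_assoc,
      mul_inv_eq_one, mul_eq_left] at this

end ConedOff

end GroupPair

theorem mainTheorem6 {G ι : Type*} [Group G] [Group.FG G] [Finite ι] [Nonempty ι]
    (P : ι → Subgroup G) (S : Set G) (hS : S.Finite) (hgen : Subgroup.closure S = ⊤) :
    GroupPair.RelFinitelyPresented P ↔ GroupPair.CoarselyUniconeSimplyConnected P S :=
  ⟨GroupPair.coarselyUniconeSimplyConnected_of_relFinitelyPresented hS hgen,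
    GroupPair.relFinitelyPresented_of_coarselyUniconeSimplyConnected hS hgen⟩
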